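/- Let $k$ be a local ring in which $2$ is invertible. Let $A=(a_{ij})_{i,j\in I}$ ($I$ finite) be a symmetrisable generalised Cartan matrix with realization $(\mathfrak h,\{\alpha_i\},\{\check\alpha_i\})$ over $\mathbb C$, let $\mathcal W\subset GL(\mathfrak h)$ be its Weyl group with simple reflections $\mathcal S=\{s_{\alpha_i}\}$, length function $\ell$ and Bruhat order $\le$, and let $\check Q=\bigoplus_i\mathbb Z\check\alpha_i$ be the coroot lattice. Put $Y_k=\check Q\otimes_{\mathbb Z}k$ and $S_k=\mathrm{Sym}(Y_k)$, $\mathbb Z$-graded with $Y_k$ in degree $2$. All $S_k$-modules are finitely generated and $\mathbb Z$-graded, and all their homomorphisms have degree $0$. For $w\in\mathcal W$ let $\mathcal G_w$ be the Bruhat moment graph on the vertex set $\{x\in\mathcal W: x\le w\}$: there is an edge $E:x\to y$ if and only if $x<y$ and $yx^{-1}=s_\alpha$ for a positive real root $\alpha$, and then its label is $l(E)=\check\alpha$. A $k$-sheaf $\mathcal F$ on $\mathcal G_w$ consists of $S_k$-modules $\mathcal F^x$ for all vertices $x$, $S_k$-modules $\mathcal F^E$ with $l(E)\mathcal F^E=0$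 for all edges $E$, and homomorphisms $\rho_{x,E}:\mathcal F^x\to\mathcal F^E$ whenever $x$ is an endpoint of $E$. Let $\mathcal F^{\delta x}\subseteq\bigoplus_{E:x\to y}\mathcal F^E$ be the set of all $(\rho_{y,E}(m_y))_{E:x\to y}$, where $(m_z)_{z>x}$ runs over the families with $m_z\in\mathcal F^z$ and $\rho_{z,F}(m_z)=\rho_{z',F}(m_{z'})$ for every edge $F$ joining two vertices $z,z'>x$. Let $\mathcal B_w$ be the Braden--MacPherson sheaf on $\mathcal G_w$, i.e. an indecomposable $k$-sheaf such that $\mathcal B_w^w\cong S_k$; for every edge $E:x\to y$ the map $\rho_{y,E}$ is surjective with kernel $l(E)\mathcal B_w^y$; and for every vertex $x$ that is the source of some edge, $\bigoplus_{E:x\to y}\rho_{x,E}:\mathcal B_w^x\to\mathcal B_w^{\delta x}$ is a projective cover in the category of graded $S_k$-modules. Assume that $(\mathcal G_w,k)$ is a GKM-pair, i.e. any two distinct edges of $\mathcal G_w$ with a common vertex have labels whose images in $Y_k$ are $k$-linearly independent. Let $s\in\mathcal S$ be such that $ws<w$. Then right multiplication by $s$ maps $\{x\in\mathcal W:x\le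 w\}$ to itself, and for every edge $E$ of $\mathcal G_w$ with endpoints $x,z$ there is exactly one edge $Es$ of $\mathcal G_w$ with endpoints $xs,zs$. Moreover there exist isomorphisms of graded $S_k$-modules $$\varphi^y:\mathcal B_w^y\to\mathcal B_w^{ys}\quad(y\le w),\qquad \varphi^E:\mathcal B_w^E\to\mathcal B_w^{Es}\quad(E\text{ an edge of }\mathcal G_w)$$ such that $\rho_{ys,Es}\circ\varphi^y=\varphi^E\circ\rho_{y,E}$ for every vertex $y\le w$ and every edge $E$ having $y$ as an endpoint, and such that $\varphi^{ys}=(\varphi^y)^{-1}$ for all $y\le w$ and $\varphi^{Es}=(\varphi^E)^{-1}$ for all edges $E$. -/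

import Mathlib

open scoped TensorProduct

universe v

/-! ## Graded modules over the symmetric algebra of a lattice -/

/-- `S_k = Sym(Y_k)`, the symmetric algebra of `Y_k = k ⊗ Y`. -/
abbrev LatticeSym (k : Type*) [CommRing k] (Y : Type*) [AddCommGroup Y] : Type _ :=
  SymmetricAlgebra k (k ⊗[ℤ] Y)

/-- The image of `y ∈ Y` in `S_k`. -/
noncomputable def symOf (k : Type*) [CommRing k] {Y : Type*} [AddCommGroup Y] (y : Y) :
    LatticeSym k Y :=
  SymmetricAlgebra.ι k (k ⊗[ℤ] Y) ((1 : k) ⊗ₜ[ℤ] y)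

/-- The `ℤ`-grading of `S_k` with `Y_k` in degree `2`: the component of degree `2d` is spanned by
the `d`-fold products of elements of `Y_k`; the components of odd or negative degree vanish. -/
noncomputable def symGrade (k : Type*) [CommRing k] (Y : Type*) [AddCommGroup Y] (i : ℤ) :
    Submodule k (LatticeSym k Y) :=
  ⨆ (d : ℕ) (_ : i = 2 * (d : ℤ)), LinearMap.range (SymmetricAlgebra.ι k (k ⊗[ℤ] Y)) ^ d

/-- Finitely generated `ℤ`-graded `S_k`-modules. -/
structure GrMod (k : Type*) [CommRing k] (Y : Type*) [AddCommGroup Y] where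
  carrier : Type v
  [addCommGroup : AddCommGroup carrier]
  [module : Module (LatticeSym k Y) carrier]
  [finite : Module.Finite (LatticeSym k Y) carrier]
  /-- the homogeneous components -/
  deg : ℤ → AddSubgroup carrier
  isInternal : DirectSum.IsInternal deg
  smul_mem : ∀ (i j : ℤ) (a : LatticeSym k Y) (m : carrier),
    a ∈ symGrade k Y i → m ∈ deg j → a • m ∈ deg (i + j)

attribute [instance] GrMod.addCommGroup GrMod.module GrMod.finite

instance (k : Type*) [CommRing k] (Y : Type*) [AddCommGroup Y] :
    CoeSort (GrMod.{v} k Y) (Type v) := ⟨GrMod.carrier⟩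

section Graded

variable {k : Type*} [CommRing k] {Y : Type*} [AddCommGroup Y]

/-- Morphisms of graded `S_k`-modules (of degree zero). -/
structure GrHom (M N : GrMod.{v} k Y) extends M →ₗ[LatticeSym k Y] N where
  map_mem : ∀ (i : ℤ) (m : M), m ∈ M.deg i → toLinearMap m ∈ N.deg i

/-- Isomorphisms of graded `S_k`-modules (of degree zero). -/
structure GrIso (M N : GrMod.{v} k Y) extends M ≃ₗ[LatticeSym k Y] N where
  map_mem_iff : ∀ (i : ℤ) (m : M), toLinearEquiv m ∈ N.deg i ↔ m ∈ M.deg i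

/-- Homogeneous submodules: those generated by their homogeneous elements. -/
def GrMod.IsHomogeneous (M : GrMod.{v} k Y) (L : Submodule (LatticeSym k Y) M) : Prop :=
  L = Submodule.span (LatticeSym k Y) {m : M | m ∈ L ∧ ∃ i : ℤ, m ∈ M.deg i}

/-- `f : M → D`, where `D` is a submodule of `N`, is a projective cover of graded modules: `M` is
projective, `f` maps `M` onto `D`, and `f` is essential, i.e. no proper graded submodule of `M`
is mapped onto `D`. (A graded module is projective in the category of graded modules if and only
if it is projective as a module.) -/
def IsGradedProjectiveCover (M : GrMod.{v} k Y) {N : Type*} [AddCommGroup N]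
    [Module (LatticeSym k Y) N] (f : M →ₗ[LatticeSym k Y] N) (D : Submodule (LatticeSym k Y) N) : Prop :=
  Module.Projective (LatticeSym k Y) M ∧
  LinearMap.range f = D ∧
  ∀ L : Submodule (LatticeSym k Y) M, M.IsHomogeneous L → L.map f = D → L = ⊤

end Graded

/-! ## Moment graphs -/

/-- A moment graph on `Y` with ordered vertex set `V`. `Adj x y` means that there is a (unique)
directed edge `x → y`. Since directed edges strictly increase, there are no directed cycles. -/
structure MomentGraph (V : Type*) [PartialOrder V] (Y : Type*) [AddCommGroup Y] where
  Adj : V → V → Prop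
  lt_of_adj : ∀ {x y : V}, Adj x y → x < y
  label : ∀ {x y : V}, Adj x y → Y
  label_ne_zero : ∀ {x y : V} (h : Adj x y), label h ≠ 0

namespace MomentGraph

variable {V : Type*} [PartialOrder V] {Y : Type*} [AddCommGroup Y]

/-- The edges `src → tgt` of a moment graph. -/
structure Edge (G : MomentGraph V Y) where
  src : V
  tgt : V
  adj : G.Adj src tgt

/-- The label `l(E)`. -/
def Edge.label {G : MomentGraph V Y} (E : G.Edge) : Y := G.label E.adj

/-- The vertex `x` lies on the boundary of the edge `E`. -/
def Edge.Incident {G : MomentGraph V Y} (E : G.Edge) (x : V) : Prop := E.src = x ∨ E.tgt = x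

/-- The edges starting at `x`. -/
abbrev OutEdge (G : MomentGraph V Y) (x : V) : Type _ := {E : G.Edge // E.src = x}

/-- The full subgraph on a set of vertices. -/
def induce (G : MomentGraph V Y) (I : Set V) : MomentGraph I Y where
  Adj x y := G.Adj x y
  lt_of_adj h := G.lt_of_adj h
  label h := G.label h
  label_ne_zero h := G.label_ne_zero h

/-- `(G, k)` is a GKM-pair: distinct edges with a common vertex have labels that are
`k`-linearly independent in `k ⊗ Y`. -/
def IsGKMPair (k : Type*) [CommRing k] (G : MomentGraph V Y) : Prop :=
  ∀ E E' : G.Edge, E ≠ E' → (∃ x : V, E.Incident x ∧ E'.Incident x) →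
    LinearIndependent k ![(1 : k) ⊗ₜ[ℤ] E.label, (1 : k) ⊗ₜ[ℤ] E'.label]

end MomentGraph

/-! ## Sheaves on moment graphs -/

/-- `k`-sheaves on a moment graph. -/
structure KSheaf (k : Type*) [CommRing k] {V : Type*} [PartialOrder V] {Y : Type*}
    [AddCommGroup Y] (G : MomentGraph V Y) where
  stalk : V → GrMod.{v} k Y
  edge : G.Edge → GrMod.{v} k Y
  label_smul : ∀ (E : G.Edge) (m : edge E), symOf k E.label • m = 0
  res : ∀ (x : V) (E : G.Edge), E.Incident x → GrHom (stalk x) (edge E)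

namespace KSheaf

variable {k : Type*} [CommRing k] {V : Type*} [PartialOrder V] {Y : Type*} [AddCommGroup Y]
  {G : MomentGraph V Y}

/-- The restriction map `ρ_{x,E}` as a linear map. -/
def rho (F : KSheaf.{v} k G) (x : V) (E : G.Edge) (h : E.Incident x) :
    F.stalk x →ₗ[LatticeSym k Y] F.edge E :=
  (F.res x E h).toLinearMap

/-- The local sections `Γ(I, F)`. -/
def sections (F : KSheaf.{v} k G) (I : Set V) :
    Submodule (LatticeSym k Y) (∀ x : I, F.stalk x) where
  carrier := {m | ∀ (E : G.Edge) (hs : E.src ∈ I) (ht : E.tgt ∈ I),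
    F.rho E.src E (Or.inl rfl) (m ⟨E.src, hs⟩) = F.rho E.tgt E (Or.inr rfl) (m ⟨E.tgt, ht⟩)}
  add_mem' := by
    intro a b ha hb E hs ht
    simp only [Pi.add_apply, map_add, ha E hs ht, hb E hs ht]
  zero_mem' := by
    intro E hs ht
    simp only [Pi.zero_apply, map_zero]
  smul_mem' := by
    intro c a ha E hs ht
    simp only [Pi.smul_apply, map_smul, ha E hs ht]

/-- `d_x : F^x → ⨁_{E : x → y} F^E`. -/
def dMap (F : KSheaf.{v} k G) (x : V) :
    F.stalk x →ₗ[LatticeSym k Y] (∀ E : G.OutEdge x, F.edge E.1) :=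
  LinearMap.pi fun E => F.rho x E.1 (Or.inl E.2)

/-- `⨁_{y > x} F^y → ⨁_{E : x → y} F^E`, the sum of the maps `ρ_{y,E}`. -/
def uMap (F : KSheaf.{v} k G) (x : V) :
    (∀ y : Set.Ioi x, F.stalk y) →ₗ[LatticeSym k Y] (∀ E : G.OutEdge x, F.edge E.1) :=
  LinearMap.pi fun E =>
    (F.rho E.1.tgt E.1 (Or.inr rfl)).comp
      (LinearMap.proj (R := LatticeSym k Y) (φ := fun y : Set.Ioi x => (F.stalk y : Type v))
        (⟨E.1.tgt, lt_of_eq_of_lt E.2.symm (G.lt_of_adj E.1.adj)⟩ : Set.Ioi x))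

/-- `F^{δx}`, the image of `Γ({> x}, F)` in `⨁_{E : x → y} F^E`. -/
def deltaStalk (F : KSheaf.{v} k G) (x : V) :
    Submodule (LatticeSym k Y) (∀ E : G.OutEdge x, F.edge E.1) :=
  (F.sections (Set.Ioi x)).map (F.uMap x)

/-- Graded subsheaves. -/
structure Subsheaf (F : KSheaf.{v} k G) where
  stalk : ∀ x : V, Submodule (LatticeSym k Y) (F.stalk x)
  edge : ∀ E : G.Edge, Submodule (LatticeSym k Y) (F.edge E)
  stalk_homogeneous : ∀ x : V, (F.stalk x).IsHomogeneous (stalk x)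
  edge_homogeneous : ∀ E : G.Edge, (F.edge E).IsHomogeneous (edge E)
  res_mem : ∀ (x : V) (E : G.Edge) (h : E.Incident x) (m : F.stalk x),
    m ∈ stalk x → F.rho x E h m ∈ edge E

/-- The zero subsheaf condition. -/
def Subsheaf.IsZero {F : KSheaf.{v} k G} (N : F.Subsheaf) : Prop :=
  (∀ x : V, N.stalk x = ⊥) ∧ ∀ E : G.Edge, N.edge E = ⊥

/-- `F` is the internal direct sum of two subsheaves. -/
def Subsheaf.IsCompl {F : KSheaf.{v} k G} (N N' : F.Subsheaf) : Prop :=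
  (∀ x : V, _root_.IsCompl (N.stalk x) (N'.stalk x)) ∧
    ∀ E : G.Edge, _root_.IsCompl (N.edge E) (N'.edge E)

/-- Indecomposable sheaves: non-zero, and not the direct sum of two non-zero sheaves. -/
def IsIndecomposable (F : KSheaf.{v} k G) : Prop :=
  ((∃ x : V, Nontrivial (F.stalk x)) ∨ ∃ E : G.Edge, Nontrivial (F.edge E)) ∧
    ∀ N N' : F.Subsheaf, N.IsCompl N' → N.IsZero ∨ N'.IsZero

/-- `F` is a Braden–MacPherson (canonical) sheaf on a moment graph with highest vertex `⊤`. -/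
structure IsBradenMacPherson [OrderTop V] (F : KSheaf.{v} k G) : Prop where
  indecomposable : F.IsIndecomposable
  stalk_top : ∃ e : F.stalk ⊤ ≃ₗ[LatticeSym k Y] LatticeSym k Y,
    ∀ (i : ℤ) (m : F.stalk ⊤), m ∈ (F.stalk ⊤).deg i ↔ e m ∈ symGrade k Y i
  rho_tgt_surjective : ∀ E : G.Edge, Function.Surjective (F.rho E.tgt E (Or.inr rfl))
  rho_tgt_ker : ∀ (E : G.Edge) (m : F.stalk E.tgt),
    F.rho E.tgt E (Or.inr rfl) m = 0 ↔ ∃ m' : F.stalk E.tgt, m = symOf k E.label • m'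
  cover : ∀ x : V, Nonempty (G.OutEdge x) →
    IsGradedProjectiveCover (F.stalk x) (F.dMap x) (F.deltaStalk x)

end KSheaf

/-! ## Weyl groups of Kac–Moody algebras and their Bruhat graphs -/

/-- Symmetrisable generalised Cartan matrices. -/
structure IsSymmetrizableGCM {ι : Type*} (A : Matrix ι ι ℤ) : Prop where
  diag : ∀ i, A i i = 2
  nonpos : ∀ i j, i ≠ j → A i j ≤ 0
  zero_symm : ∀ i j, A i j = 0 → A j i = 0
  symmetrizable : ∃ d : ι → ℂ, (∀ i, d i ≠ 0) ∧ ∀ i j, d i * (A i j : ℂ) = d j * (A j i : ℂ)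

/-- A realization `(h, Π, Π^∨)` of a generalised Cartan matrix `A`: the Cartan subalgebra `h` of
the Kac–Moody algebra `g(A)`, with its simple roots and simple coroots. -/
structure KMRealization {ι : Type*} [Fintype ι] [DecidableEq ι] (A : Matrix ι ι ℤ)
    (H : Type*) [AddCommGroup H] [Module ℂ H] where
  gcm : IsSymmetrizableGCM A
  finite : Module.Finite ℂ H
  root : ι → Module.Dual ℂ H
  coroot : ι → H
  root_linearIndependent : LinearIndependent ℂ root
  coroot_linearIndependent : LinearIndependent ℂ coroot
  root_coroot : ∀ i j, root j (coroot i) = (A i j : ℂ)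
  finrank_add_rank :
    Module.finrank ℂ H + (A.map (Int.cast : ℤ → ℂ)).rank = 2 * Fintype.card ι

namespace KMRealization

variable {ι : Type*} [Fintype ι] [DecidableEq ι] {A : Matrix ι ι ℤ}
  {H : Type*} [AddCommGroup H] [Module ℂ H]

lemma root_coroot_self (R : KMRealization A H) (i : ι) : R.root i (R.coroot i) = 2 := by
  rw [R.root_coroot, R.gcm.diag]; norm_num

/-- The simple reflection `λ ↦ λ - ⟨α_i, λ⟩ α_i^∨` of `h`. -/
noncomputable def simpleReflection (R : KMRealization A H) (i : ι) : H ≃ₗ[ℂ] H :=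
  Module.reflection (R.root_coroot_self i)

/-- The Weyl group, as a group of automorphisms of `h`. It acts on `h^*` by
`w α = α ∘ w⁻¹`, which identifies it with the group generated by the simple reflections of `h^*`. -/
def weylGroup (R : KMRealization A H) : Subgroup (H ≃ₗ[ℂ] H) :=
  Subgroup.closure (Set.range R.simpleReflection)

/-- The simple reflection `s_i` as an element of the Weyl group. -/
noncomputable def simple (R : KMRealization A H) (i : ι) : R.weylGroup :=
  ⟨R.simpleReflection i, Subgroup.subset_closure ⟨i, rfl⟩⟩

/-- The coroot lattice. -/
abbrev corootLattice (R : KMRealization A H) : Submodule ℤ H :=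
  Submodule.span ℤ (Set.range R.coroot)

/-- `α` is a positive real root with coroot `β`: there are `w` and `i` with `α = w α_i` and
`β = w α_i^∨`, and `α` is a sum of simple roots. -/
def IsPosRealRoot (R : KMRealization A H) (α : Module.Dual ℂ H) (β : H) : Prop :=
  (∃ (w : R.weylGroup) (i : ι),
    (∀ v : H, α v = R.root i ((w⁻¹ : R.weylGroup).1 v)) ∧ β = w.1 (R.coroot i)) ∧
  α ∈ AddSubmonoid.closure (Set.range R.root)

/-- `t` is the reflection `s_α` in a positive real root `α` whose coroot is `β`. -/
def IsReflectionAlong (R : KMRealization A H) (t : R.weylGroup) (β : R.corootLattice) : Prop :=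
  ∃ α : Module.Dual ℂ H, R.IsPosRealRoot α β ∧ ∀ v : H, t.1 v = v - α v • (β : H)

/-- The set `T` of reflections. -/
def IsReflection (R : KMRealization A H) (t : R.weylGroup) : Prop :=
  ∃ β : R.corootLattice, R.IsReflectionAlong t β

/-- The length function with respect to the simple reflections. -/
noncomputable def length (R : KMRealization A H) (w : R.weylGroup) : ℕ :=
  sInf {n : ℕ | ∃ l : List ι, l.length = n ∧ (l.map R.simple).prod = w}

/-- The Bruhat order: generated by `x < t x` for reflections `t` with `ℓ(x) < ℓ(t x)`. -/
instance bruhatOrder (R : KMRealization A H) : PartialOrder R.weylGroup where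
  le := Relation.ReflTransGen
    (fun x y : R.weylGroup => R.IsReflection (y * x⁻¹) ∧ R.length x < R.length y)
  le_refl _ := Relation.ReflTransGen.refl
  le_trans _ _ _ := Relation.ReflTransGen.trans
  le_antisymm := by
    have key : ∀ x y : R.weylGroup, Relation.ReflTransGen
        (fun x y : R.weylGroup => R.IsReflection (y * x⁻¹) ∧ R.length x < R.length y) x y →
        x = y ∨ R.length x < R.length y := by
      intro x y h
      induction h with
      | refl => exact Or.inl rfl
      | tail _ h ih =>
        rcases ih with rfl | ih
        · exact Or.inr h.2
        · exact Or.inr (ih.trans h.2)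
    intro x y hxy hyx
    rcases key x y hxy with h | h
    · exact h
    · rcases key y x hyx with h' | h'
      · exact h'.symm
      · exact absurd h' (lt_asymm h)

/-- The Bruhat graph of the Weyl group, on the coroot lattice: `x → y` is an edge if `x < y` and
`y x⁻¹` is the reflection `s_α` in a positive real root `α`, and its label is the coroot of `α`. -/
noncomputable def bruhatGraph (R : KMRealization A H) :
    MomentGraph R.weylGroup R.corootLattice where
  Adj x y := x < y ∧ ∃ β : R.corootLattice, R.IsReflectionAlong (y * x⁻¹) β
  lt_of_adj h := h.1
  label h := h.2.choose
  label_ne_zero := by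
    intro x y h h0
    obtain ⟨α, ⟨⟨w, i, -, hw⟩, -⟩, -⟩ := h.2.choose_spec
    rw [h0, ZeroMemClass.coe_zero] at hw
    exact R.coroot_linearIndependent.ne_zero i
      ((LinearEquiv.map_eq_zero_iff w.1).mp hw.symm)

/-- The full subgraph of the Bruhat graph on the vertices `≤ w`. -/
noncomputable abbrev bruhatGraphBelow (R : KMRealization A H) (w : R.weylGroup) :
    MomentGraph (Set.Iic w) R.corootLattice :=
  R.bruhatGraph.induce (Set.Iic w)

/-- `x' = x s`. -/
def IsRightTranslate (R : KMRealization A H) {w : R.weylGroup} (s : R.weylGroup)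
    (x x' : Set.Iic w) : Prop :=
  (x' : R.weylGroup) = (x : R.weylGroup) * s

/-- `E' = E s`: if `E` joins `x` and `z`, then `E'` joins `x s` and `z s` (in either direction). -/
def IsRightTranslateEdge (R : KMRealization A H) {w : R.weylGroup} (s : R.weylGroup)
    (E E' : (R.bruhatGraphBelow w).Edge) : Prop :=
  (R.IsRightTranslate s E.src E'.src ∧ R.IsRightTranslate s E.tgt E'.tgt) ∨
    (R.IsRightTranslate s E.src E'.tgt ∧ R.IsRightTranslate s E.tgt E'.src)

end KMRealization

/-!
Write `xs` for right multiplication by the simple reflection `s = s_i`. The edge `x → tx` of the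
Bruhat graph and its translate, with endpoints `xs` and `txs`, have the same label, since the label
depends on the reflection `t` only. So the stalks of `B` at `x` and `xs` are projective covers of
very similar modules, and the isomorphisms are built downwards along the order, a pair `{x, xs}` at
a time.

*Combinatorics.* Real roots are positive or negative (`act_root_mem_or_neg_mem`; reduction to rank
two as for Coxeter groups, but with the generalised Cartan matrix directly). This gives the strong
exchange property (`exists_word_refl_mul`) and the Z-property
(`IsReflection.mul_simple_eq_or_length_lt`): if `x < tx`, then `tx = xs` or `xs < txs`. Hence
`{x ≤ w}` is stable under `s`, only the edges `x → xs` ("vertical" edges) are reversed by `s`, and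
`max (ℓ x) (ℓ (xs))` is a level function that increases along all other relations. What is used of
this afterwards is collected in `MomentGraph.FoldingSymmetry`.

*The inductive step* (`exists_stalkIso`). Suppose that isomorphisms `φ` are given above the level of
a pair `x = ys < y`. They act on the sections over the higher levels by twisting. The section
`c_z = z α_i^∨` of the structure algebra satisfies `c_{zs} = -c_z`, and `c_z` is, up to sign, the
label of the vertical edge at `z`. For a section `γ` the difference of `γ` and its twist vanishes on
the vertical edges, so it is `c` times a family `ν`, and by the GKM condition `ν` is again a section
(`exists_section_of_sub_twist`). Consequently, if `m` in the stalk at `y` matches `γ`, one can change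
`m` by a multiple of `c_y`, which is invisible on the edge `x → y`, such that it matches the twist of
`γ` (`exists_stalk_of_twist`). This says precisely that the stalks at `x` and at `y` cover the same
module, and uniqueness of projective covers, in the relational form `exists_grIso_of_relation`,
gives the isomorphism. At the top vertex, which is not a projective cover, essentiality holds because
`S_k` is generated in degree `0` (`eq_top_of_equiv_symAlgebra`).

The algebraic input is that labels are not zero divisors and that labels of different edges at a
vertex are regular modulo each other. A label is part of a basis of the coroot lattice, so modulo it
the symmetric algebra is still a polynomial ring over `k`, and McCoy's theorem applies although `k`
may have zero divisors (`exists_eq_symOf_basis_mul`).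
-/

namespace KMRealization

variable {ι : Type*} [Fintype ι] [DecidableEq ι] {A : Matrix ι ι ℤ}
  {H : Type*} [AddCommGroup H] [Module ℂ H] (R : KMRealization A H)

/-! ### Length and parity -/

lemma simple_apply (i : ι) (v : H) :
    (R.simple i).1 v = v - R.root i v • R.coroot i :=
  Module.reflection_apply v (R.root_coroot_self i)

lemma simple_mul_self (i : ι) : R.simple i * R.simple i = 1 := by
  ext v
  exact Module.involutive_reflection (R.root_coroot_self i) v

lemma simple_inv (i : ι) : (R.simple i)⁻¹ = R.simple i :=
  inv_eq_of_mul_eq_one_left (R.simple_mul_self i)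

lemma mul_simple_cancel (w : R.weylGroup) (i : ι) : w * R.simple i * R.simple i = w := by
  rw [mul_assoc, R.simple_mul_self, mul_one]

lemma simple_mul_cancel (w : R.weylGroup) (i : ι) : R.simple i * (R.simple i * w) = w := by
  rw [← mul_assoc, R.simple_mul_self, one_mul]

lemma exists_word (w : R.weylGroup) : ∃ l : List ι, (l.map R.simple).prod = w := by
  obtain ⟨w, hw⟩ := w
  induction hw using Subgroup.closure_induction with
  | mem x hx => obtain ⟨i, rfl⟩ := hx; exact ⟨[i], by simp; rfl⟩
  | one => exact ⟨[], rfl⟩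
  | mul x y hx hy ihx ihy =>
    obtain ⟨l, hl⟩ := ihx
    obtain ⟨l', hl'⟩ := ihy
    exact ⟨l ++ l', by rw [List.map_append, List.prod_append, hl, hl']; rfl⟩
  | inv x hx ih =>
    obtain ⟨l, hl⟩ := ih
    refine ⟨l.reverse, ?_⟩
    have : ∀ l : List ι, (l.reverse.map R.simple).prod = ((l.map R.simple).prod)⁻¹ := by
      intro l
      induction l with
      | nil => simp
      | cons a l ih =>
        rw [List.reverse_cons, List.map_append, List.prod_append, ih, List.map_cons, List.prod_cons]
        simp [R.simple_inv]
    rw [this, hl]; rfl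

lemma exists_reduced_word (w : R.weylGroup) :
    ∃ l : List ι, l.length = R.length w ∧ (l.map R.simple).prod = w := by
  obtain ⟨l, hl⟩ := R.exists_word w
  exact Nat.sInf_mem (s := {n : ℕ | ∃ l : List ι, l.length = n ∧ (l.map R.simple).prod = w})
    ⟨_, l, rfl, hl⟩

lemma length_prod_le (l : List ι) : R.length (l.map R.simple).prod ≤ l.length :=
  Nat.sInf_le ⟨l, rfl, rfl⟩

@[simp] lemma length_one : R.length 1 = 0 := Nat.le_zero.1 (R.length_prod_le [])

lemma length_mul_le (x y : R.weylGroup) : R.length (x * y) ≤ R.length x + R.length y := by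
  obtain ⟨l, hl, rfl⟩ := R.exists_reduced_word x
  obtain ⟨l', hl', rfl⟩ := R.exists_reduced_word y
  rw [← hl, ← hl', ← List.prod_append, ← List.map_append, ← List.length_append]
  exact R.length_prod_le _

lemma length_simple_le (i : ι) : R.length (R.simple i) ≤ 1 := by
  simpa using R.length_prod_le [i]

/-- The sign character of the Weyl group. -/
noncomputable def sign : R.weylGroup →* ℂˣ := LinearEquiv.det.comp R.weylGroup.subtype

lemma sign_simple (i : ι) : R.sign (R.simple i) = -1 := by
  have := R.finite
  apply Units.ext
  rw [sign, MonoidHom.comp_apply, LinearEquiv.coe_det, Units.val_neg, Units.val_one]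
  change LinearMap.det (R.simple i).1.toLinearMap = -1
  have : (R.simple i).1.toLinearMap = LinearMap.transvection (R.root i) (-R.coroot i) := by
    ext v
    simp [LinearMap.transvection.apply, R.simple_apply, sub_eq_add_neg]
  rw [this, LinearMap.transvection.det, map_neg, R.root_coroot_self]
  norm_num

lemma sign_eq (w : R.weylGroup) : R.sign w = (-1) ^ R.length w := by
  obtain ⟨l, hl, hw⟩ := R.exists_reduced_word w
  rw [← hl, ← hw]
  clear hl hw
  induction l with
  | nil => simp
  | cons i l ih => simp [ih, R.sign_simple, pow_succ']

/-- The lengths have different parity, since a reflection has determinant `-1`. -/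
lemma length_mul_simple_ne (w : R.weylGroup) (i : ι) :
    R.length (w * R.simple i) ≠ R.length w := by
  intro h
  have h1 := R.sign_eq (w * R.simple i)
  rw [h, ← R.sign_eq, map_mul, R.sign_simple, mul_eq_left] at h1
  have := congrArg Units.val h1
  norm_num at this

lemma length_mul_simple_le (w : R.weylGroup) (i : ι) :
    R.length (w * R.simple i) ≤ R.length w + 1 :=
  (R.length_mul_le _ _).trans (Nat.add_le_add_left (R.length_simple_le i) _)

lemma length_le_mul_simple (w : R.weylGroup) (i : ι) :
    R.length w ≤ R.length (w * R.simple i) + 1 := by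
  simpa [R.mul_simple_cancel] using R.length_mul_simple_le (w * R.simple i) i

lemma exists_descent {w : R.weylGroup} (hw : w ≠ 1) :
    ∃ j, R.length (w * R.simple j) < R.length w := by
  obtain ⟨l, hl, rfl⟩ := R.exists_reduced_word w
  rcases List.eq_nil_or_concat' l with rfl | ⟨l, j, rfl⟩
  · simp at hw
  · refine ⟨j, ?_⟩
    rw [← hl]
    have := R.length_prod_le l
    simp [R.mul_simple_cancel]
    omega

/-! ### The action on roots -/

/-- The action of the Weyl group on linear forms, `w α = α ∘ w⁻¹`. -/
noncomputable def act (w : R.weylGroup) : Module.Dual ℂ H →ₗ[ℂ] Module.Dual ℂ H :=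
  LinearMap.lcomp ℂ ℂ (w⁻¹ : R.weylGroup).1.toLinearMap

lemma act_apply (w : R.weylGroup) (α : Module.Dual ℂ H) (v : H) :
    R.act w α v = α ((w⁻¹ : R.weylGroup).1 v) := rfl

@[simp] lemma act_one (α : Module.Dual ℂ H) : R.act 1 α = α := by
  ext v; simp [act_apply]

lemma act_mul (x y : R.weylGroup) (α : Module.Dual ℂ H) :
    R.act (x * y) α = R.act x (R.act y α) := by
  ext v; simp only [act_apply, mul_inv_rev]; rfl

lemma act_inv_act (x : R.weylGroup) (α : Module.Dual ℂ H) : R.act x⁻¹ (R.act x α) = α := by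
  rw [← R.act_mul, inv_mul_cancel, R.act_one]

lemma act_simple (i : ι) (α : Module.Dual ℂ H) :
    R.act (R.simple i) α = α - α (R.coroot i) • R.root i := by
  ext v
  rw [act_apply, R.simple_inv, R.simple_apply]
  simp [mul_comm]

lemma act_simple_root (i j : ι) :
    R.act (R.simple i) (R.root j) = R.root j - (A i j : ℂ) • R.root i := by
  rw [R.act_simple, R.root_coroot]

lemma act_simple_root_self (i : ι) : R.act (R.simple i) (R.root i) = -R.root i := by
  rw [R.act_simple, R.root_coroot_self, two_smul]; abel

/-- The cone of sums of simple roots. -/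
abbrev posCone : AddSubmonoid (Module.Dual ℂ H) := AddSubmonoid.closure (Set.range R.root)

lemma root_mem_posCone (i : ι) : R.root i ∈ R.posCone := AddSubmonoid.subset_closure ⟨i, rfl⟩

lemma mem_posCone_iff {α : Module.Dual ℂ H} :
    α ∈ R.posCone ↔ ∃ c : ι → ℕ, α = ∑ i, (c i : ℂ) • R.root i := by
  constructor
  · intro h
    induction h using AddSubmonoid.closure_induction with
    | mem x hx =>
      obtain ⟨i, rfl⟩ := hx
      exact ⟨Pi.single i 1, by simp [Pi.single_apply]⟩
    | zero => exact ⟨0, by simp⟩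
    | add x y _ _ hx hy =>
      obtain ⟨c, rfl⟩ := hx
      obtain ⟨d, rfl⟩ := hy
      exact ⟨c + d, by simp [add_smul, Finset.sum_add_distrib]⟩
  · rintro ⟨c, rfl⟩
    refine sum_mem fun i _ => ?_
    rw [Nat.cast_smul_eq_nsmul]
    exact nsmul_mem (R.root_mem_posCone i) _

lemma nonneg_smul_mem {α : Module.Dual ℂ H} (hα : α ∈ R.posCone) {n : ℤ} (hn : 0 ≤ n) :
    (n : ℂ) • α ∈ R.posCone := by
  lift n to ℕ using hn
  rw [Int.cast_natCast, Nat.cast_smul_eq_nsmul]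
  exact nsmul_mem hα _

lemma coeff_unique {c d : ι → ℂ} (h : ∑ i, c i • R.root i = ∑ i, d i • R.root i) : c = d := by
  funext i
  have h0 : ∑ i, (c i - d i) • R.root i = 0 := by
    simp [sub_smul, Finset.sum_sub_distrib, h]
  exact sub_eq_zero.1 (Fintype.linearIndependent_iff.1 R.root_linearIndependent _ h0 i)

lemma eq_zero_of_mem_posCone {α : Module.Dual ℂ H} (h : α ∈ R.posCone) (h' : -α ∈ R.posCone) :
    α = 0 := by
  obtain ⟨c, hc⟩ := R.mem_posCone_iff.1 h
  obtain ⟨d, hd⟩ := R.mem_posCone_iff.1 h'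
  have h0 : ∑ i, ((c i + d i : ℕ) : ℂ) • R.root i = ∑ i, (0 : ℂ) • R.root i := by
    simp only [Nat.cast_add, add_smul, Finset.sum_add_distrib, ← hc, ← hd]
    simp
  have h1 := R.coeff_unique h0
  rw [hc]
  refine Finset.sum_eq_zero fun i _ => ?_
  have h2 : (c i + d i : ℕ) = 0 := by exact_mod_cast congrFun h1 i
  have : c i = 0 := by omega
  simp [this]

lemma act_root_ne_zero (w : R.weylGroup) (i : ι) : R.act w (R.root i) ≠ 0 := by
  intro h
  have := R.act_inv_act w (R.root i)
  rw [h, map_zero] at this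
  exact R.root_linearIndependent.ne_zero i this.symm

/-! ### Rank two: alternating words -/

/-- The alternating word `⋯ s_i s_j` with `n` letters, the last one being `s_j`. -/
noncomputable def alt (i j : ι) : ℕ → R.weylGroup
  | 0 => 1
  | n + 1 => R.simple (if Even n then j else i) * alt i j n

lemma length_alt_le (i j : ι) (n : ℕ) : R.length (R.alt i j n) ≤ n := by
  induction n with
  | zero => simp [alt]
  | succ n ih =>
    rw [alt]
    have := R.length_mul_le (R.simple (if Even n then j else i)) (R.alt i j n)
    have := R.length_simple_le (if Even n then j else i)
    omega

lemma alt_add (i j : ι) (a b : ℕ) :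
    ∃ p, R.length p ≤ a ∧ R.alt i j (a + b) = p * R.alt i j b := by
  induction a with
  | zero => exact ⟨1, by simp, by simp⟩
  | succ a ih =>
    obtain ⟨p, hp, h⟩ := ih
    refine ⟨R.simple (if Even (a + b) then j else i) * p, ?_, ?_⟩
    · have := R.length_mul_le (R.simple (if Even (a + b) then j else i)) p
      have := R.length_simple_le (if Even (a + b) then j else i)
      omega
    · rw [show a + 1 + b = a + b + 1 by ring, alt, h, mul_assoc]

/-- The coefficients at `α_i` and `α_j` of the root obtained from `α_i` by `alt i j n`, for
`a = -a_{ij}` and `b = -a_{ji}`. -/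
def altCoeff (a b : ℤ) : ℕ → ℤ × ℤ
  | 0 => (1, 0)
  | n + 1 =>
    if Even n then ((altCoeff a b n).1, b * (altCoeff a b n).1 - (altCoeff a b n).2)
    else (a * (altCoeff a b n).2 - (altCoeff a b n).1, (altCoeff a b n).2)

lemma act_alt (i j : ι) (n : ℕ) :
    R.act (R.alt i j n) (R.root i) =
      ((altCoeff (-A i j) (-A j i) n).1 : ℂ) • R.root i +
        ((altCoeff (-A i j) (-A j i) n).2 : ℂ) • R.root j := by
  induction n with
  | zero => simp [alt, altCoeff]
  | succ n ih =>
    rw [alt, R.act_mul, ih, altCoeff]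
    split_ifs
    · simp only [map_add, map_smul, R.act_simple_root, R.gcm.diag]
      push_cast
      module
    · simp only [map_add, map_smul, R.act_simple_root, R.gcm.diag]
      push_cast
      module

/-- If `a b ≥ 4`, all coefficients are non-negative: the coefficient that is replaced next is at most
half of what it is subtracted from. -/
lemma altCoeff_nonneg_of_four_le {a b : ℤ} (ha : 0 ≤ a) (hb : 0 ≤ b) (hab : 4 ≤ a * b) (n : ℕ) :
    0 ≤ (altCoeff a b n).1 ∧ 0 ≤ (altCoeff a b n).2 ∧
      (if Even n then 2 * (altCoeff a b n).2 ≤ b * (altCoeff a b n).1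
        else 2 * (altCoeff a b n).1 ≤ a * (altCoeff a b n).2) := by
  induction n with
  | zero => simp [altCoeff, hb]
  | succ n ih =>
    obtain ⟨h1, h2, h3⟩ := ih
    rw [altCoeff]
    by_cases hn : Even n
    · rw [if_pos hn] at h3
      simp only [hn, if_true, Nat.even_add_one, not_true, if_false]
      refine ⟨h1, by linarith, ?_⟩
      nlinarith [mul_le_mul_of_nonneg_left h3 ha, mul_le_mul_of_nonneg_right hab h1]
    · rw [if_neg hn] at h3
      simp only [hn, if_false, Nat.even_add_one, not_false_iff, if_true]
      refine ⟨by linarith, h2, ?_⟩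
      nlinarith [mul_le_mul_of_nonneg_left h3 hb, mul_le_mul_of_nonneg_right hab h2]

/-- The action of `s_i` in the coordinates of `v + ℂ α_i^∨ + ℂ α_j^∨`. -/
lemma simple_sub_left (i j : ι) (v : H) (P Q : ℂ) :
    (R.simple i).1 (v - P • R.coroot i - Q • R.coroot j) =
      v - (R.root i v - P - (A j i : ℂ) * Q) • R.coroot i - Q • R.coroot j := by
  rw [R.simple_apply]
  simp only [map_sub, map_smul, R.root_coroot, R.gcm.diag, smul_eq_mul]
  push_cast
  module

lemma simple_sub_right (i j : ι) (v : H) (P Q : ℂ) :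
    (R.simple j).1 (v - P • R.coroot i - Q • R.coroot j) =
      v - P • R.coroot i - (R.root j v - Q - (A i j : ℂ) * P) • R.coroot j := by
  rw [R.simple_apply]
  simp only [map_sub, map_smul, R.root_coroot, R.gcm.diag, smul_eq_mul]
  push_cast
  module

lemma alt_one (i j : ι) : R.alt i j 1 = R.simple j := by simp [alt]

/-- Either the root obtained from `α_i` by the alternating word with `k` letters is a non-negative
combination of `α_i` and `α_j`, or `s_i` and `s_j` satisfy a braid relation of length at most `k`.
The second case occurs for `a_{ij} a_{ji} ≤ 3` only, with braid lengths `2`, `3`, `4` and `6`. -/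
lemma altCoeff_nonneg_or_braid {i j : ι} (hij : i ≠ j) (k : ℕ) :
    (0 ≤ (altCoeff (-A i j) (-A j i) k).1 ∧ 0 ≤ (altCoeff (-A i j) (-A j i) k).2) ∨
      ∃ m, 1 ≤ m ∧ m ≤ k ∧ R.alt i j m = R.alt j i m := by
  have ha : 0 ≤ -A i j := by have := R.gcm.nonpos i j hij; omega
  have hb : 0 ≤ -A j i := by have := R.gcm.nonpos j i hij.symm; omega
  by_cases h4 : 4 ≤ -A i j * -A j i
  · have := altCoeff_nonneg_of_four_le ha hb h4 k
    exact Or.inl ⟨this.1, this.2.1⟩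
  have h0 := R.gcm.zero_symm i j
  have h0' := R.gcm.zero_symm j i
  obtain ⟨a, haA⟩ : ∃ a, -A i j = a := ⟨_, rfl⟩
  obtain ⟨b, hbA⟩ : ∃ b, -A j i = b := ⟨_, rfl⟩
  have haA' : (A i j : ℂ) = -(a : ℂ) := by rw [← haA]; push_cast; ring
  have hbA' : (A j i : ℂ) = -(b : ℂ) := by rw [← hbA]; push_cast; ring
  have hz : a = 0 → b = 0 := fun h => by have := h0 (by omega); omega
  have hz' : b = 0 → a = 0 := fun h => by have := h0' (by omega); omega
  rw [haA, hbA] at h4 ⊢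
  rw [haA] at ha
  rw [hbA] at hb
  clear h0 h0' haA hbA
  have ha4 : a < 4 := by
    by_contra h
    rcases hb.eq_or_lt with h' | h'
    · have := hz' h'.symm; omega
    · nlinarith
  have hb4 : b < 4 := by
    by_contra h
    rcases ha.eq_or_lt with h' | h'
    · have := hz h'.symm; omega
    · nlinarith
  have braid : ∀ m, 1 ≤ m → R.alt i j m = R.alt j i m →
      (∀ l, l < m → 0 ≤ (altCoeff a b l).1 ∧ 0 ≤ (altCoeff a b l).2) →
      (0 ≤ (altCoeff a b k).1 ∧ 0 ≤ (altCoeff a b k).2) ∨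
      ∃ m, 1 ≤ m ∧ m ≤ k ∧ R.alt i j m = R.alt j i m := by
    intro m hm h1 h2
    rcases lt_or_ge k m with h | h
    · exact Or.inl (h2 k h)
    · exact Or.inr ⟨m, hm, h, h1⟩
  have ext_alt : ∀ m, (∀ v : H, (R.alt i j m).1 (v - (0 : ℂ) • R.coroot i - (0 : ℂ) • R.coroot j) =
      (R.alt j i m).1 (v - (0 : ℂ) • R.coroot i - (0 : ℂ) • R.coroot j)) →
      R.alt i j m = R.alt j i m := by
    intro m h
    ext v
    simpa using h v
  have h_cases : (a = 0 ∧ b = 0) ∨ (a = 1 ∧ b = 1) ∨ (a = 1 ∧ b = 2) ∨ (a = 2 ∧ b = 1) ∨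
      (a = 1 ∧ b = 3) ∨ (a = 3 ∧ b = 1) := by
    interval_cases a <;> interval_cases b <;> omega
  have even_two : ¬ Even 1 ∧ Even 2 ∧ ¬ Even 3 ∧ Even 4 ∧ ¬ Even 5 := by decide
  obtain ⟨e1, e2, e3, e4, e5⟩ := even_two
  rcases h_cases with ⟨rfl, rfl⟩ | ⟨rfl, rfl⟩ | ⟨rfl, rfl⟩ | ⟨rfl, rfl⟩ | ⟨rfl, rfl⟩ | ⟨rfl, rfl⟩
  · refine braid 2 (by norm_num) (ext_alt _ fun v => ?_) (fun l hl => ?_)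
    · simp [alt, e1, simple_sub_left, simple_sub_right, haA', hbA', -zero_smul, -sub_zero]
    · interval_cases l <;> simp [altCoeff]
  · refine braid 3 (by norm_num) (ext_alt _ fun v => ?_) (fun l hl => ?_)
    · simp [alt, e1, e2, simple_sub_left, simple_sub_right, haA', hbA', -zero_smul, -sub_zero]
      module
    · interval_cases l <;> simp [altCoeff]
  · refine braid 4 (by norm_num) (ext_alt _ fun v => ?_) (fun l hl => ?_)
    · simp [alt, e1, e2, e3, simple_sub_left, simple_sub_right, haA', hbA', -zero_smul, -sub_zero]
      module
    · interval_cases l <;> simp [altCoeff, e1, e2]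
  · refine braid 4 (by norm_num) (ext_alt _ fun v => ?_) (fun l hl => ?_)
    · simp [alt, e1, e2, e3, simple_sub_left, simple_sub_right, haA', hbA', -zero_smul, -sub_zero]
      module
    · interval_cases l <;> simp [altCoeff, e1, e2]
  · refine braid 6 (by norm_num) (ext_alt _ fun v => ?_) (fun l hl => ?_)
    · simp [alt, e1, e2, e3, e4, e5, simple_sub_left, simple_sub_right, haA', hbA', -zero_smul,
        -sub_zero]
      module
    · interval_cases l <;> simp [altCoeff, e1, e2, e3, e4]
  · refine braid 6 (by norm_num) (ext_alt _ fun v => ?_) (fun l hl => ?_)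
    · simp [alt, e1, e2, e3, e4, e5, simple_sub_left, simple_sub_right, haA', hbA', -zero_smul,
        -sub_zero]
      module
    · interval_cases l <;> simp [altCoeff, e1, e2, e3, e4]

/-! ### Positivity of roots -/

/-- If `ℓ(w s_i) > ℓ(w)`, then the root `w α_i` is positive. -/
theorem act_root_mem_posCone (w : R.weylGroup) (i : ι)
    (hw : R.length w < R.length (w * R.simple i)) : R.act w (R.root i) ∈ R.posCone := by
  induction hn : R.length w using Nat.strong_induction_on generalizing w i with
  | _ n ih =>
  by_cases h1 : w = 1
  · rw [h1, R.act_one]; exact R.root_mem_posCone i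
  obtain ⟨j, hj⟩ := R.exists_descent h1
  have hij : i ≠ j := by rintro rfl; omega
  -- Strip off a maximal alternating word in `s_i`, `s_j` from the right of `w`.
  let P : Set R.weylGroup := {v | ∃ k, w = v * R.alt i j k ∧ R.length w = R.length v + k}
  have hP : P.Nonempty := ⟨w, 0, by simp [alt], rfl⟩
  obtain ⟨v, ⟨k, hk, hlk⟩, hmin⟩ : ∃ v ∈ P, ∀ v' ∈ P, R.length v ≤ R.length v' :=
    ⟨Function.argminOn R.length P hP, Function.argminOn_mem _ _ _,
      fun v' hv' => Function.argminOn_le _ _ hv'⟩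
  have hjP : w * R.simple j ∈ P :=
    ⟨1, by rw [R.alt_one, R.mul_simple_cancel], by have := R.length_le_mul_simple w j; omega⟩
  have hvw := hmin _ hjP
  have hdesc : ∀ e, e = i ∨ e = j → R.length v < R.length (v * R.simple e) := by
    intro e he
    by_contra hlt
    have hne := R.length_mul_simple_ne v e
    have hle := R.length_le_mul_simple v e
    by_cases hek : e = if Even k then j else i
    · have : v * R.simple e ∈ P := by
        refine ⟨k + 1, ?_, by omega⟩
        rw [alt, ← hek, mul_assoc, R.simple_mul_cancel]
        exact hk
      have := hmin _ this
      omega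
    · obtain ⟨k, rfl⟩ : ∃ k', k = k' + 1 := ⟨k - 1, by omega⟩
      have hek' : e = if Even k then j else i := by
        rcases he with rfl | rfl <;> by_cases hk : Even k <;> simp_all [Nat.even_add_one]
      rw [alt, ← hek', ← mul_assoc] at hk
      have h2 := R.length_mul_le (v * R.simple e) (R.alt i j k)
      have h3 := R.length_alt_le i j k
      rw [← hk] at h2
      omega
  have hvi := ih (R.length v) (by omega) v i (hdesc i (Or.inl rfl)) rfl
  have hvj := ih (R.length v) (by omega) v j (hdesc j (Or.inr rfl)) rfl
  rcases R.altCoeff_nonneg_or_braid hij k with ⟨hp, hq⟩ | ⟨m, hm1, hmk, hm⟩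
  · rw [hk, R.act_mul, R.act_alt, map_add, map_smul, map_smul]
    exact add_mem (R.nonneg_smul_mem hvi hp) (R.nonneg_smul_mem hvj hq)
  · -- By the braid relation, `w` also ends in `s_i`, which is impossible.
    exfalso
    obtain ⟨a, rfl⟩ := Nat.exists_eq_add_of_le' hmk
    obtain ⟨b, rfl⟩ := Nat.exists_eq_add_of_le' hm1
    obtain ⟨p, hp, hpa⟩ := R.alt_add i j a (b + 1)
    obtain ⟨q, hq, hqa⟩ := R.alt_add j i b 1
    have : w * R.simple i = v * (p * q) := by
      rw [hk, hpa, hm, hqa, R.alt_one]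
      simp only [mul_assoc, R.simple_mul_self, mul_one]
    rw [this] at hw
    have h2 := R.length_mul_le v (p * q)
    have h3 := R.length_mul_le p q
    omega

/-- Every real root is positive or negative. -/
theorem act_root_mem_or_neg_mem (w : R.weylGroup) (i : ι) :
    R.act w (R.root i) ∈ R.posCone ∨ -R.act w (R.root i) ∈ R.posCone := by
  rcases lt_or_gt_of_ne (R.length_mul_simple_ne w i) with h | h
  · right
    have := R.act_root_mem_posCone (w * R.simple i) i (by rwa [R.mul_simple_cancel])
    rwa [R.act_mul, R.act_simple_root_self, map_neg] at this
  · exact Or.inl (R.act_root_mem_posCone w i h)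

/-- An element of the Weyl group that maps all simple roots to positive roots is trivial. -/
lemma eq_one_of_act_root_mem {w : R.weylGroup}
    (h : ∀ i, R.act w (R.root i) ∈ R.posCone) : w = 1 := by
  by_contra h1
  obtain ⟨j, hj⟩ := R.exists_descent h1
  have := R.act_root_mem_posCone (w * R.simple j) j (by rwa [R.mul_simple_cancel])
  rw [R.act_mul, R.act_simple_root_self, map_neg] at this
  exact R.act_root_ne_zero w j (R.eq_zero_of_mem_posCone (h j) this)

/-! ### Reflections -/

/-- The reflection `w s_i w⁻¹` in the root `w α_i`. -/
noncomputable def refl (w : R.weylGroup) (i : ι) : R.weylGroup := w * R.simple i * w⁻¹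

lemma refl_apply (w : R.weylGroup) (i : ι) (v : H) :
    (R.refl w i).1 v = v - R.act w (R.root i) v • w.1 (R.coroot i) := by
  change w.1 ((R.simple i).1 ((w⁻¹ : R.weylGroup).1 v)) = _
  rw [R.simple_apply, map_sub, map_smul, R.act_apply]
  congr 1
  change (w * w⁻¹).1 v = v
  rw [mul_inv_cancel]; rfl

lemma refl_mul_self (w : R.weylGroup) (i : ι) : R.refl w i * R.refl w i = 1 := by
  simp only [refl, mul_assoc, inv_mul_cancel_left]
  rw [← mul_assoc (R.simple i), R.simple_mul_self, one_mul, mul_inv_cancel]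

lemma refl_inv (w : R.weylGroup) (i : ι) : (R.refl w i)⁻¹ = R.refl w i :=
  inv_eq_of_mul_eq_one_left (R.refl_mul_self w i)

lemma refl_mul (x w : R.weylGroup) (i : ι) : R.refl (x * w) i = x * R.refl w i * x⁻¹ := by
  simp only [refl, mul_inv_rev, mul_assoc]

lemma refl_mul_simple (w : R.weylGroup) (i : ι) : R.refl (w * R.simple i) i = R.refl w i := by
  simp only [refl, mul_inv_rev, R.simple_inv, ← mul_assoc, R.mul_simple_cancel]

lemma act_refl_root (w : R.weylGroup) (i : ι) :
    R.act (R.refl w i) (R.act w (R.root i)) = -R.act w (R.root i) := by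
  rw [← R.act_mul, refl, inv_mul_cancel_right, R.act_mul, R.act_simple_root_self, map_neg]

/-- A root determines its reflection. Roots and coroots are only related through the Weyl group, so
this is not immediate: the product of the two reflections is shown to map all simple roots to
positive roots. -/
lemma refl_eq_simple {w : R.weylGroup} {i j : ι} (h : R.act w (R.root i) = R.root j) :
    R.refl w i = R.simple j := by
  have h1 : R.refl w i * R.simple j = 1 := by
    refine R.eq_one_of_act_root_mem fun l => ?_
    by_cases hl : l = j
    · subst hl
      rw [R.act_mul, R.act_simple_root_self, map_neg, ← h, R.act_refl_root, neg_neg, h]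
      exact R.root_mem_posCone l
    · -- The coefficient of `α_l` is `1`, so the root is not negative.
      obtain ⟨c, hc⟩ : ∃ c : ℂ, R.act (R.refl w i * R.simple j) (R.root l) =
          R.root l + c • R.root j := by
        refine ⟨A j l - R.root l (w.1 (R.coroot i)), ?_⟩
        ext v
        rw [act_apply, mul_inv_rev, R.refl_inv, R.simple_inv]
        change R.root l ((R.simple j).1 ((R.refl w i).1 v)) = _
        rw [R.refl_apply, h, R.simple_apply]
        have h2 : R.root j (w.1 (R.coroot i)) = 2 := by
          rw [← h, act_apply]
          change R.root i ((w⁻¹ * w).1 _) = 2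
          rw [inv_mul_cancel]
          exact R.root_coroot_self i
        simp [R.root_coroot, h2]
        ring
      rcases R.act_root_mem_or_neg_mem (R.refl w i * R.simple j) l with h' | h'
      · exact h'
      · exfalso
        rw [hc] at h'
        obtain ⟨d, hd⟩ := R.mem_posCone_iff.1 h'
        have := congrFun (R.coeff_unique (c := -Pi.single l 1 - Pi.single j c)
          (d := fun i => (d i : ℂ)) (by
            rw [← hd]
            simp [Pi.single_apply, sub_smul, Finset.sum_sub_distrib, ite_smul]
            abel)) l
        simp [hl] at this
        have h3 : ((d l + 1 : ℕ) : ℂ) = 0 := by push_cast; rw [← this]; ring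
        exact absurd (Nat.cast_eq_zero.1 h3) (by omega)
  rw [← R.simple_inv, eq_inv_of_mul_eq_one_left h1]

/-- A multiple of a simple root is a root only if it is that simple root. -/
lemma act_root_eq_of_eq_smul {w : R.weylGroup} {i j : ι} {n : ℕ}
    (h : R.act w (R.root i) = (n : ℂ) • R.root j) : R.act w (R.root i) = R.root j := by
  have h1 : R.root i = (n : ℂ) • R.act w⁻¹ (R.root j) := by
    rw [← map_smul, ← h, R.act_inv_act]
  have key : ∀ d : ι → ℤ, R.act w⁻¹ (R.root j) = ∑ l, (d l : ℂ) • R.root l → (n : ℤ) * d i = 1 := by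
    intro d hd
    have := congrFun (R.coeff_unique (c := Pi.single i 1) (d := fun l => (n : ℂ) * d l) (by
      rw [hd, Finset.smul_sum] at h1
      simp only [smul_smul] at h1
      rw [← h1]
      simp [Pi.single_apply])) i
    simp only [Pi.single_eq_same] at this
    exact_mod_cast this.symm
  have hn : n = 1 := by
    have : ∃ d : ι → ℤ, R.act w⁻¹ (R.root j) = ∑ l, (d l : ℂ) • R.root l := by
      rcases R.act_root_mem_or_neg_mem w⁻¹ j with h' | h'
      · obtain ⟨c, hc⟩ := R.mem_posCone_iff.1 h'
        exact ⟨fun l => c l, by simpa using hc⟩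
      · obtain ⟨c, hc⟩ := R.mem_posCone_iff.1 h'
        exact ⟨fun l => -c l, by simp [← hc]⟩
    obtain ⟨d, hd⟩ := this
    have := Int.isUnit_iff.1 (IsUnit.of_mul_eq_one _ (key d hd))
    omega
  simpa [hn] using h

/-- The simple reflection `s_j` permutes the positive roots other than `α_j`. -/
lemma act_root_eq_of_neg_act_simple_mem {w : R.weylGroup} {i j : ι}
    (h : R.act w (R.root i) ∈ R.posCone)
    (h' : -R.act (R.simple j) (R.act w (R.root i)) ∈ R.posCone) :
    R.act w (R.root i) = R.root j := by
  obtain ⟨c, hc⟩ := R.mem_posCone_iff.1 h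
  obtain ⟨d, hd⟩ := R.mem_posCone_iff.1 h'
  rw [R.act_simple, neg_sub] at hd
  obtain ⟨n, hn⟩ : ∃ n : ℂ, R.act w (R.root i) (R.coroot j) = n := ⟨_, rfl⟩
  rw [hn, hc] at hd
  have h0 := R.coeff_unique (c := Pi.single j n) (d := fun l => ((c l + d l : ℕ) : ℂ)) (by
    simp only [Nat.cast_add, add_smul, Finset.sum_add_distrib, ← hd]
    simp [Pi.single_apply])
  have hcl : ∀ l, l ≠ j → c l = 0 := by
    intro l hl
    have := congrFun h0 l
    rw [Pi.single_eq_of_ne hl] at this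
    have : c l + d l = 0 := by exact_mod_cast this.symm
    omega
  refine R.act_root_eq_of_eq_smul (n := c j) ?_
  rw [hc]
  refine Finset.sum_eq_single j (fun l _ hl => ?_) (by simp)
  simp [hcl l hl]

/-- Strong exchange: if the positive root `w α_i` becomes negative under `x⁻¹`, then multiplying a
word for `x` with the corresponding reflection amounts to deleting one letter. -/
lemma exists_word_refl_mul (l : List ι) (w : R.weylGroup) (i : ι)
    (h : R.act w (R.root i) ∈ R.posCone)
    (h' : -R.act ((l.map R.simple).prod)⁻¹ (R.act w (R.root i)) ∈ R.posCone) :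
    ∃ l' : List ι, l'.length + 1 = l.length ∧
      (l'.map R.simple).prod = R.refl w i * (l.map R.simple).prod := by
  induction l generalizing w with
  | nil =>
    simp only [List.map_nil, List.prod_nil, inv_one, R.act_one] at h'
    exact absurd (R.eq_zero_of_mem_posCone h h') (R.act_root_ne_zero w i)
  | cons j l ih =>
    rw [List.map_cons, List.prod_cons, mul_inv_rev, R.simple_inv, R.act_mul] at h'
    rcases R.act_root_mem_or_neg_mem (R.simple j * w) i with h1 | h1
    · obtain ⟨l', hl', hp⟩ := ih (R.simple j * w) h1 (by rwa [R.act_mul])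
      refine ⟨j :: l', by simpa using hl', ?_⟩
      rw [List.map_cons, List.prod_cons, hp, R.refl_mul, R.simple_inv, List.map_cons,
        List.prod_cons]
      simp only [← mul_assoc, R.simple_mul_self, one_mul]
    · rw [R.act_mul] at h1
      refine ⟨l, rfl, ?_⟩
      rw [R.refl_eq_simple (R.act_root_eq_of_neg_act_simple_mem h h1), List.map_cons,
        List.prod_cons, R.simple_mul_cancel]

lemma length_refl_mul_lt {x w : R.weylGroup} {i : ι} (h : R.act w (R.root i) ∈ R.posCone)
    (h' : -R.act x⁻¹ (R.act w (R.root i)) ∈ R.posCone) :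
    R.length (R.refl w i * x) < R.length x := by
  obtain ⟨l, hl, rfl⟩ := R.exists_reduced_word x
  obtain ⟨l', hl', hp⟩ := R.exists_word_refl_mul l w i h h'
  have := R.length_prod_le l'
  rw [hp] at this
  omega

lemma length_lt_refl_mul {x w : R.weylGroup} {i : ι} (h : R.act w (R.root i) ∈ R.posCone)
    (h' : R.act x⁻¹ (R.act w (R.root i)) ∈ R.posCone) :
    R.length x < R.length (R.refl w i * x) := by
  have := R.length_refl_mul_lt (x := R.refl w i * x) h (by
    rwa [mul_inv_rev, R.act_mul, R.refl_inv, R.act_refl_root, map_neg, neg_neg])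
  rwa [← mul_assoc, R.refl_mul_self, one_mul] at this

lemma apply_mem_corootLattice (w : R.weylGroup) {v : H} (hv : v ∈ R.corootLattice) :
    w.1 v ∈ R.corootLattice := by
  obtain ⟨l, rfl⟩ := R.exists_word w
  induction l with
  | nil => exact hv
  | cons j l ih =>
    rw [List.map_cons, List.prod_cons]
    change (R.simple j).1 (((l.map R.simple).prod).1 v) ∈ _
    generalize ((l.map R.simple).prod).1 v = u at ih ⊢
    clear hv
    induction ih using Submodule.span_induction with
    | mem x hx =>
      obtain ⟨m, rfl⟩ := hx
      rw [R.simple_apply, R.root_coroot, Int.cast_smul_eq_zsmul]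
      exact sub_mem (Submodule.subset_span ⟨m, rfl⟩)
        (Submodule.smul_mem _ _ (Submodule.subset_span ⟨j, rfl⟩))
    | zero => simp
    | add x y _ _ hx hy => rw [map_add]; exact add_mem hx hy
    | smul a x _ hx => rw [map_zsmul]; exact Submodule.smul_mem _ _ hx

lemma isReflection_iff {t : R.weylGroup} :
    R.IsReflection t ↔ ∃ w i, t = R.refl w i ∧ R.act w (R.root i) ∈ R.posCone := by
  constructor
  · rintro ⟨β, α, ⟨⟨w, i, hα, hβ⟩, hp⟩, ht⟩
    have hα' : α = R.act w (R.root i) := by ext v; exact hα v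
    subst hα'
    refine ⟨w, i, ?_, hp⟩
    ext v
    rw [ht, R.refl_apply, hβ]
  · rintro ⟨w, i, rfl, hp⟩
    exact ⟨⟨w.1 (R.coroot i), R.apply_mem_corootLattice w (Submodule.subset_span ⟨i, rfl⟩)⟩, R.act w (R.root i),
      ⟨⟨w, i, fun v => rfl, rfl⟩, hp⟩, R.refl_apply w i⟩

lemma isReflection_refl (w : R.weylGroup) (i : ι) : R.IsReflection (R.refl w i) := by
  rcases R.act_root_mem_or_neg_mem w i with h | h
  · exact R.isReflection_iff.2 ⟨w, i, rfl, h⟩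
  · refine R.isReflection_iff.2 ⟨w * R.simple i, i, (R.refl_mul_simple w i).symm, ?_⟩
    rwa [R.act_mul, R.act_simple_root_self, map_neg]

/-- The Z-property of the Bruhat graph: right multiplication by `s_i` preserves the direction of all
edges `x → t x` except for those with `t x = x s_i`. -/
lemma IsReflection.mul_simple_eq_or_length_lt {R : KMRealization A H} {t : R.weylGroup}
    (ht : R.IsReflection t) {x : R.weylGroup} (hx : R.length x < R.length (t * x)) (i : ι) :
    t * x = x * R.simple i ∨ R.length (x * R.simple i) < R.length (t * (x * R.simple i)) := by
  obtain ⟨w, j, rfl, hp⟩ := R.isReflection_iff.1 ht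
  have h1 : R.act (x⁻¹ * w) (R.root j) ∈ R.posCone := by
    rcases R.act_root_mem_or_neg_mem (x⁻¹ * w) j with h | h
    · exact h
    · rw [R.act_mul] at h
      exact absurd (R.length_refl_mul_lt hp h) (by omega)
  rcases R.act_root_mem_or_neg_mem (R.simple i * (x⁻¹ * w)) j with h | h
  · right
    refine R.length_lt_refl_mul hp ?_
    rwa [mul_inv_rev, R.simple_inv, ← R.act_mul, mul_assoc]
  · left
    rw [R.act_mul] at h
    have := R.refl_eq_simple (R.act_root_eq_of_neg_act_simple_mem h1 h)
    rw [← this, R.refl_mul, inv_inv]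
    simp only [← mul_assoc, mul_inv_cancel, one_mul]

/-! ### The Bruhat order and right multiplication by a simple reflection -/

lemma IsReflection.lt_mul {R : KMRealization A H} {t : R.weylGroup} (ht : R.IsReflection t)
    {x : R.weylGroup} (h : R.length x < R.length (t * x)) : x < t * x := by
  refine lt_of_le_of_ne (Relation.ReflTransGen.single ⟨?_, h⟩) ?_
  · rwa [mul_inv_cancel_right]
  · intro h'
    rw [← h'] at h
    exact lt_irrefl _ h

lemma exists_step_of_lt {R : KMRealization A H} {x y : R.weylGroup} (h : x < y) :
    ∃ t, R.IsReflection t ∧ R.length x < R.length (t * x) ∧ t * x ≤ y := by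
  rcases Relation.ReflTransGen.cases_head h.le with h' | ⟨z, ⟨hz, hl⟩, hzy⟩
  · exact absurd h' h.ne
  · exact ⟨z * x⁻¹, hz, by rwa [inv_mul_cancel_right], by rw [inv_mul_cancel_right]; exact hzy⟩

lemma length_mono : Monotone R.length := by
  intro x y h
  induction h using Relation.ReflTransGen.head_induction_on with
  | refl => exact le_rfl
  | head h _ ih => exact h.2.le.trans ih

lemma length_strictMono : StrictMono R.length := by
  intro x y h
  obtain ⟨t, -, hl, hle⟩ := exists_step_of_lt h
  exact hl.trans_le (R.length_mono hle)

lemma simple_isReflection_conj (x : R.weylGroup) (i : ι) :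
    R.IsReflection (x * R.simple i * x⁻¹) := R.isReflection_refl x i

lemma conj_mul (x : R.weylGroup) (i : ι) :
    x * R.simple i * x⁻¹ * x = x * R.simple i := by rw [inv_mul_cancel_right]

lemma lt_mul_simple_or (x : R.weylGroup) (i : ι) : x < x * R.simple i ∨ x * R.simple i < x := by
  have h : ∀ y : R.weylGroup, R.length y < R.length (y * R.simple i) → y < y * R.simple i := by
    intro y hy
    have := (R.simple_isReflection_conj y i).lt_mul (x := y) (by rwa [R.conj_mul])
    rwa [R.conj_mul] at this
  rcases lt_or_gt_of_ne (R.length_mul_simple_ne x i) with h' | h'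
  · right
    simpa [R.mul_simple_cancel] using h (x * R.simple i) (by rwa [R.mul_simple_cancel])
  · exact Or.inl (h x h')

/-- The lifting property of the Bruhat order. -/
lemma mul_simple_le {w : R.weylGroup} {i : ι} (hw : w * R.simple i < w) {x : R.weylGroup}
    (hx : x ≤ w) : x * R.simple i ≤ w := by
  induction hx using Relation.ReflTransGen.head_induction_on with
  | refl => exact hw.le
  | @head x y h hy ih =>
    obtain ⟨t, rfl⟩ : ∃ t, y = t * x := ⟨y * x⁻¹, by simp⟩
    rw [mul_inv_cancel_right] at h
    rcases h.1.mul_simple_eq_or_length_lt h.2 i with h' | h'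
    · rw [← h']; exact hy
    · refine (h.1.lt_mul h').le.trans ?_
      rwa [← mul_assoc]

/-- The larger of the lengths of `x` and `x s_i`. -/
noncomputable def pairLength (i : ι) (x : R.weylGroup) : ℕ :=
  max (R.length x) (R.length (x * R.simple i))

lemma pairLength_mul_simple (i : ι) (x : R.weylGroup) :
    R.pairLength i (x * R.simple i) = R.pairLength i x := by
  rw [pairLength, pairLength, R.mul_simple_cancel, max_comm]

/-- The function `pairLength` strictly increases along the Bruhat order, except within the pairs
`{x, x s_i}`. -/
lemma eq_mul_simple_or_pairLength_lt (i : ι) {x y : R.weylGroup} (h : x < y) :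
    y = x * R.simple i ∨ R.pairLength i x < R.pairLength i y := by
  have key : ∀ x y : R.weylGroup, x ≤ y →
      x = y ∨ y = x * R.simple i ∨ R.pairLength i x < R.pairLength i y := by
    intro x y h
    induction h using Relation.ReflTransGen.head_induction_on with
    | refl => exact Or.inl rfl
    | @head x z h hy ih =>
      obtain ⟨t, rfl⟩ : ∃ t, z = t * x := ⟨z * x⁻¹, by simp⟩
      rw [mul_inv_cancel_right] at h
      rcases h.1.mul_simple_eq_or_length_lt h.2 i with h' | h'
      · rw [h', R.mul_simple_cancel, R.pairLength_mul_simple] at ih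
        tauto
      · right; right
        have h1 : R.pairLength i x < R.pairLength i (t * x) := by
          have := h.2
          rw [pairLength, pairLength, mul_assoc]
          omega
        rcases ih with rfl | rfl | ih
        · exact h1
        · rwa [R.pairLength_mul_simple]
        · exact h1.trans ih
  exact (key x y h.le).resolve_left h.ne

lemma finite_Iic (w : R.weylGroup) : (Set.Iic w).Finite := by
  refine ((List.finite_length_le ι (R.length w)).image fun l => (l.map R.simple).prod).subset ?_
  intro x hx
  obtain ⟨l, hl, rfl⟩ := R.exists_reduced_word x
  exact ⟨l, hl.trans_le (R.length_mono hx), rfl⟩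

/-! ### Edges and labels of the Bruhat graph -/

lemma bruhatGraph_adj_mul_simple {x y : R.weylGroup} (h : R.bruhatGraph.Adj x y) (i : ι) :
    y = x * R.simple i ∨ R.bruhatGraph.Adj (x * R.simple i) (y * R.simple i) := by
  obtain ⟨h1, h2⟩ := h
  obtain ⟨t, rfl⟩ : ∃ t, y = t * x := ⟨y * x⁻¹, by simp⟩
  rw [mul_inv_cancel_right] at h2
  refine (IsReflection.mul_simple_eq_or_length_lt h2 (R.length_strictMono h1) i).imp id fun h3 => ?_
  rw [mul_assoc]
  exact ⟨IsReflection.lt_mul h2 h3, by rwa [mul_inv_cancel_right]⟩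

lemma bruhatGraph_adj_vertical {x : R.weylGroup} {i : ι} (h : x < x * R.simple i) :
    R.bruhatGraph.Adj x (x * R.simple i) :=
  ⟨h, R.simple_isReflection_conj x i⟩

/-- The label of an edge is a choice that depends on its reflection only. -/
lemma bruhatGraph_label_congr {x y x' y' : R.weylGroup} (h : R.bruhatGraph.Adj x y)
    (h' : R.bruhatGraph.Adj x' y') (he : y * x⁻¹ = y' * x'⁻¹) :
    R.bruhatGraph.label h = R.bruhatGraph.label h' := by
  obtain ⟨h1, h2⟩ := h
  obtain ⟨h1', h2'⟩ := h'
  change Exists.choose _ = Exists.choose _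
  congr 1
  rw [he]

lemma bruhatGraph_exists_label {x y : R.weylGroup} (h : R.bruhatGraph.Adj x y) :
    ∃ u j, y * x⁻¹ = R.refl u j ∧ (R.bruhatGraph.label h : H) = u.1 (R.coroot j) := by
  obtain ⟨α, ⟨⟨u, j, hα, hβ⟩, -⟩, ht⟩ := h.2.choose_spec
  refine ⟨u, j, ?_, hβ⟩
  have hα' : α = R.act u (R.root j) := by ext v; exact hα v
  subst hα'
  ext v
  rw [ht, R.refl_apply, hβ]

/-- The basis of the coroot lattice formed by the images of the simple coroots under `u`. -/
noncomputable def corootBasis (u : R.weylGroup) : Module.Basis ι ℤ R.corootLattice := by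
  refine Module.Basis.mk (v := fun i => ⟨u.1 (R.coroot i),
    R.apply_mem_corootLattice u (Submodule.subset_span ⟨i, rfl⟩)⟩) ?_ ?_
  · refine LinearIndependent.of_comp R.corootLattice.subtype ?_
    refine LinearIndependent.restrict_scalars (K := ℂ) ?_ ?_
    · intro a b h
      simpa using h
    · exact R.coroot_linearIndependent.map' u.1.toLinearMap u.1.ker
  · rintro ⟨v, hv⟩ -
    have h1 : (u⁻¹ : R.weylGroup).1 v ∈ R.corootLattice := R.apply_mem_corootLattice _ hv
    have h2 : ∀ a ∈ R.corootLattice, ∃ h : u.1 a ∈ R.corootLattice,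
        (⟨u.1 a, h⟩ : R.corootLattice) ∈ Submodule.span ℤ (Set.range fun i =>
          (⟨u.1 (R.coroot i), R.apply_mem_corootLattice u (Submodule.subset_span ⟨i, rfl⟩)⟩ :
            R.corootLattice)) := by
      intro a ha
      refine ⟨R.apply_mem_corootLattice u ha, ?_⟩
      induction ha using Submodule.span_induction with
      | mem x hx => obtain ⟨i, rfl⟩ := hx; exact Submodule.subset_span ⟨i, rfl⟩
      | zero => convert Submodule.zero_mem _ using 1; ext; simp
      | add x y hx hy hx' hy' =>
        convert Submodule.add_mem _ hx' hy' using 1; ext; simp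
      | smul n x hx hx' =>
        convert Submodule.smul_mem _ n hx' using 1; ext; simp
    obtain ⟨h, h3⟩ := h2 _ h1
    convert h3
    change v = (u * u⁻¹).1 v
    rw [mul_inv_cancel]; rfl

lemma coe_corootBasis (u : R.weylGroup) (i : ι) :
    (R.corootBasis u i : H) = u.1 (R.coroot i) := by
  simp [corootBasis]

/-- Roots are integral on the coroot lattice. -/
lemma exists_int_act_root (u : R.weylGroup) (j : ι) {v : H} (hv : v ∈ R.corootLattice) :
    ∃ n : ℤ, R.act u (R.root j) v = n := by
  rw [act_apply]
  have := R.apply_mem_corootLattice u⁻¹ hv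
  generalize (u⁻¹ : R.weylGroup).1 v = a at this
  induction this using Submodule.span_induction with
  | mem x hx => obtain ⟨i, rfl⟩ := hx; exact ⟨A i j, R.root_coroot i j⟩
  | zero => exact ⟨0, by simp⟩
  | add x y _ _ hx hy =>
    obtain ⟨m, hm⟩ := hx
    obtain ⟨n, hn⟩ := hy
    exact ⟨m + n, by rw [map_add, hm, hn]; push_cast; rfl⟩
  | smul a x _ hx =>
    obtain ⟨n, hn⟩ := hx
    exact ⟨a * n, by rw [map_zsmul, hn]; simp⟩

/-- Proportional coroots agree up to sign. -/
lemma coroot_eq_or_eq_neg (u x : R.weylGroup) (i j : ι) {a : ℂ}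
    (h : u.1 (R.coroot j) = a • x.1 (R.coroot i)) :
    u.1 (R.coroot j) = x.1 (R.coroot i) ∨ u.1 (R.coroot j) = -x.1 (R.coroot i) := by
  have int_coeff : ∀ (u x : R.weylGroup) (i j : ι) (a : ℂ),
      u.1 (R.coroot j) = a • x.1 (R.coroot i) → ∃ n : ℤ, a = n := by
    intro u x i j a h
    obtain ⟨v, hv⟩ : ∃ v : R.corootLattice, (v : H) = u.1 (R.coroot j) :=
      ⟨R.corootBasis u j, R.coe_corootBasis u j⟩
    have hli : LinearIndependent ℂ fun i => x.1 (R.coroot i) :=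
      R.coroot_linearIndependent.map' x.1.toLinearMap x.1.ker
    have h1 := congrArg (Subtype.val : R.corootLattice → H) ((R.corootBasis x).sum_repr v)
    simp only [Submodule.coe_sum, Submodule.coe_smul, coe_corootBasis] at h1
    refine ⟨(R.corootBasis x).repr v i, ?_⟩
    have h2 : ∑ l, (((R.corootBasis x).repr v l : ℂ) - Pi.single (M := fun _ => ℂ) i a l) •
        x.1 (R.coroot l) = 0 := by
      simp only [sub_smul, Finset.sum_sub_distrib, Int.cast_smul_eq_zsmul, h1, hv, h]
      simp [Pi.single_apply]
    have := Fintype.linearIndependent_iff.1 hli _ h2 i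
    rw [Pi.single_eq_same] at this
    exact (sub_eq_zero.1 this).symm
  obtain ⟨m, rfl⟩ := int_coeff u x i j a h
  have hne : (m : ℂ) ≠ 0 := by
    rintro h0
    rw [h0, zero_smul] at h
    exact R.coroot_linearIndependent.ne_zero j ((LinearEquiv.map_eq_zero_iff u.1).1 h)
  obtain ⟨n, hn⟩ := int_coeff x u j i (m : ℂ)⁻¹ (by rw [h, inv_smul_smul₀ hne])
  have hmn : m * n = 1 := by
    have : (m : ℂ) * n = 1 := by rw [← hn, mul_inv_cancel₀ hne]
    exact_mod_cast this
  rcases Int.isUnit_iff.1 (IsUnit.of_mul_eq_one _ hmn) with rfl | rfl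
  · left; simpa using h
  · right; simpa using h

/-- The value at the vertex `x` of the section of the structure algebra given by the coroot
`x α_i^∨`. -/
noncomputable def corootAt (i : ι) (x : R.weylGroup) : R.corootLattice := R.corootBasis x i

lemma coe_corootAt (i : ι) (x : R.weylGroup) : (R.corootAt i x : H) = x.1 (R.coroot i) :=
  R.coe_corootBasis x i

lemma corootAt_mul_simple (i : ι) (x : R.weylGroup) :
    R.corootAt i (x * R.simple i) = -R.corootAt i x := by
  ext
  rw [coe_corootAt, Submodule.coe_neg, coe_corootAt]
  change x.1 ((R.simple i).1 (R.coroot i)) = _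
  rw [R.simple_apply, R.root_coroot_self, ← map_neg]
  congr 1
  module

/-- The label of the edge between `y` and `y s_i` is `± y α_i^∨`. -/
lemma label_vertical {x y : R.weylGroup} {i : ι} (h : R.bruhatGraph.Adj x y)
    (hy : y = x * R.simple i) :
    R.bruhatGraph.label h = R.corootAt i y ∨ R.bruhatGraph.label h = -R.corootAt i y := by
  obtain ⟨u, j, ht, hl⟩ := R.bruhatGraph_exists_label h
  have h1 : R.refl u j = R.refl x i := by rw [← ht, hy]; rfl
  have h2 : ∀ v, R.act u (R.root j) v • u.1 (R.coroot j) =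
      R.act x (R.root i) v • x.1 (R.coroot i) := by
    intro v
    have := congrArg (fun t : R.weylGroup => t.1 v) h1
    simp only [R.refl_apply] at this
    exact sub_right_injective this
  have h3 : R.act u (R.root j) (u.1 (R.coroot j)) = 2 := by
    rw [act_apply]
    change R.root j ((u⁻¹ * u).1 _) = 2
    rw [inv_mul_cancel]
    exact R.root_coroot_self j
  have h4 := h2 (u.1 (R.coroot j))
  rw [h3] at h4
  have h5 := R.coroot_eq_or_eq_neg u x i j
    (a := (2 : ℂ)⁻¹ * R.act x (R.root i) (u.1 (R.coroot j))) (by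
      rw [mul_smul, ← h4, inv_smul_smul₀ two_ne_zero])
  have h6 : R.corootAt i y = -R.corootAt i x := by rw [hy, R.corootAt_mul_simple]
  rw [h6, neg_neg]
  rcases h5 with h5 | h5
  · right
    ext
    rw [hl, h5, R.coe_corootAt]
  · left
    ext
    rw [hl, h5, Submodule.coe_neg, R.coe_corootAt]

/-- The coroots `x α_i^∨` form a section of the structure algebra. -/
lemma corootAt_sub_mem {x y : R.weylGroup} (i : ι) (h : R.bruhatGraph.Adj x y) :
    ∃ n : ℤ, R.corootAt i y = R.corootAt i x + n • R.bruhatGraph.label h := by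
  obtain ⟨u, j, ht, hl⟩ := R.bruhatGraph_exists_label h
  obtain ⟨n, hn⟩ := R.exists_int_act_root u j (R.corootAt i x).2
  refine ⟨-n, ?_⟩
  ext
  have hy : y = R.refl u j * x := by rw [← ht, inv_mul_cancel_right]
  have hyi : y.1 (R.coroot i) = (R.refl u j).1 (x.1 (R.coroot i)) := by rw [hy]; rfl
  rw [R.coe_corootAt] at hn
  rw [R.coe_corootAt, hyi, R.refl_apply, hn, Submodule.coe_add, Submodule.coe_smul, hl, R.coe_corootAt,
    Int.cast_smul_eq_zsmul, neg_smul, sub_eq_add_neg]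

/-- Every label is part of a basis of the coroot lattice. -/
lemma exists_basis_label {x y : R.weylGroup} (h : R.bruhatGraph.Adj x y) :
    ∃ (b : Module.Basis ι ℤ R.corootLattice) (j : ι), b j = R.bruhatGraph.label h := by
  obtain ⟨u, j, -, hl⟩ := R.bruhatGraph_exists_label h
  exact ⟨R.corootBasis u, j, by ext; rw [hl, R.coe_corootBasis]⟩

end KMRealization

/-! ### Divisibility by labels in the symmetric algebra -/

/-- A linear form whose coefficients have no common annihilator is not a zero divisor. -/
lemma MvPolynomial.eq_zero_of_linear_mul_eq_zero {k : Type*} [CommRing k] {ι : Type*} [Fintype ι]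
    (a : ι → k) (ha : ∀ c : k, (∀ i, c * a i = 0) → c = 0) (f : MvPolynomial ι k)
    (hf : (∑ i, C (a i) * X i) * f = 0) : f = 0 := by
  classical
  -- Give the variables distinct weights by powers of `T` and apply McCoy's theorem in `T`.
  let e := Fintype.equivFin ι
  let Θ : MvPolynomial ι k →ₐ[k] Polynomial (MvPolynomial ι k) :=
    aeval fun i => Polynomial.monomial (e i : ℕ) (X i)
  have hΘ : ∀ f, (Polynomial.evalRingHom 1) (Θ f) = f := by
    intro f
    induction f using MvPolynomial.induction_on with
    | C a => simp [Θ]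
    | add p q hp hq => rw [map_add, map_add, hp, hq]
    | mul_X p i hp => rw [map_mul, map_mul, hp]; simp [Θ]
  have hΘl : Θ (∑ i, C (a i) * X i) = ∑ i, Polynomial.monomial (e i : ℕ) (C (a i) * X i) := by
    simp only [Θ, map_sum, map_mul, aeval_X, aeval_C]
    refine Finset.sum_congr rfl fun i _ => ?_
    rw [← Polynomial.C_mul_monomial]
    rfl
  have hreg : Θ (∑ i, C (a i) * X i) ∈ nonZeroDivisors (Polynomial (MvPolynomial ι k)) := by
    rw [Polynomial.mem_nonZeroDivisors_iff]
    intro g hg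
    have h1 : ∀ i, g * (C (a i) * X i) = 0 := by
      intro i
      have := congrArg (fun p => Polynomial.coeff p (e i : ℕ)) hg
      simp only [hΘl, Polynomial.coeff_smul, Polynomial.finsetSum_coeff,
        Polynomial.coeff_monomial, Polynomial.coeff_zero] at this
      rw [Finset.sum_eq_single i] at this
      · simpa using this
      · intro j _ hj
        rw [if_neg]
        intro h
        exact hj (e.injective (Fin.ext h))
      · simp
    ext m
    rw [coeff_zero]
    refine ha _ fun i => ?_
    have := congrArg (coeff (m + Finsupp.single i 1)) (h1 i)
    rw [← mul_assoc, coeff_mul_X, coeff_zero, mul_comm, coeff_C_mul] at this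
    rwa [mul_comm]
  have h0 : Θ f = 0 := by
    refine (mul_left_mem_nonZeroDivisors_eq_zero_iff hreg).1 ?_
    rw [← map_mul, hf, map_zero]
  rw [← hΘ f, h0, map_zero]

section LatticeSym

variable {k : Type*} [CommRing k] {Y : Type*} [AddCommGroup Y] {ι : Type*}

lemma symOf_add (x y : Y) : symOf k (x + y) = symOf k x + symOf k y := by
  simp [symOf, TensorProduct.tmul_add]

lemma symOf_neg (x : Y) : symOf k (-x) = -symOf k x := by
  simp [symOf, TensorProduct.tmul_neg]

lemma symOf_zsmul (n : ℤ) (x : Y) : symOf k (n • x) = n • symOf k x := by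
  simp [symOf]

/-- A basis of `Y` identifies the symmetric algebra with a polynomial ring. -/
noncomputable def latticeSymEquiv (b : Module.Basis ι ℤ Y) :
    LatticeSym k Y ≃ₐ[k] MvPolynomial ι k :=
  SymmetricAlgebra.equivMvPolynomial (Algebra.TensorProduct.basis k b)

lemma latticeSymEquiv_basis (b : Module.Basis ι ℤ Y) (i : ι) :
    latticeSymEquiv b (symOf k (b i)) = MvPolynomial.X i := by
  have := SymmetricAlgebra.equivMvPolynomial_ι_apply (Algebra.TensorProduct.basis k b) i
  rwa [Algebra.TensorProduct.basis_apply] at this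

variable [Fintype ι]

lemma latticeSymEquiv_symOf (b : Module.Basis ι ℤ Y) (y : Y) :
    latticeSymEquiv b (symOf k y) =
      ∑ i, MvPolynomial.C (b.repr y i : k) * MvPolynomial.X i := by
  have key : ∀ f : ι → ℤ, latticeSymEquiv (k := k) b (symOf k (∑ i, f i • b i)) =
      ∑ i, MvPolynomial.C (f i : k) * MvPolynomial.X i := by
    intro f
    have : symOf k (∑ i, f i • b i) = ∑ i, f i • symOf k (b i) := by
      simp [symOf, TensorProduct.tmul_sum]
    rw [this, map_sum]
    refine Finset.sum_congr rfl fun i _ => ?_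
    rw [map_zsmul, latticeSymEquiv_basis, zsmul_eq_mul]
    simp
  conv_lhs => rw [← b.sum_repr y]
  exact key _

/-- Members of a basis of the lattice are not zero divisors. -/
lemma eq_zero_of_symOf_basis_mul (b : Module.Basis ι ℤ Y) (j : ι) (a : LatticeSym k Y)
    (h : symOf k (b j) * a = 0) : a = 0 := by
  classical
  have h1 := congrArg (latticeSymEquiv b) h
  rw [map_mul, latticeSymEquiv_symOf, map_zero] at h1
  have := MvPolynomial.eq_zero_of_linear_mul_eq_zero _ (fun c hc => by
    have := hc j
    simpa using this) _ h1
  exact (map_eq_zero_iff _ (latticeSymEquiv b).injective).1 this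

/-- If `β` is part of a basis of `Y` and `γ` is `k`-linearly independent of `β`, then `γ` is not a
zero divisor modulo `β`. -/
lemma exists_eq_symOf_basis_mul (b : Module.Basis ι ℤ Y) (j : ι) {y : Y}
    (hy : LinearIndependent k ![(1 : k) ⊗ₜ[ℤ] y, (1 : k) ⊗ₜ[ℤ] b j]) (a c : LatticeSym k Y)
    (h : symOf k y * a = symOf k (b j) * c) : ∃ d, a = symOf k (b j) * d := by
  classical
  let φ : MvPolynomial ι k →ₐ[k] MvPolynomial ι k :=
    MvPolynomial.aeval fun i => if i = j then 0 else MvPolynomial.X i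
  have hφ : ∀ f, ∃ q, f = φ f + MvPolynomial.X j * q := by
    intro f
    induction f using MvPolynomial.induction_on with
    | C a => exact ⟨0, by simp [φ]⟩
    | add p q hp hq =>
      obtain ⟨p', hp'⟩ := hp
      obtain ⟨q', hq'⟩ := hq
      refine ⟨p' + q', ?_⟩
      conv_lhs => rw [hp', hq']
      rw [map_add]; ring
    | mul_X p i hp =>
      obtain ⟨p', hp'⟩ := hp
      by_cases hi : i = j
      · subst hi
        exact ⟨p, by simp [φ, mul_comm]⟩
      · refine ⟨p' * MvPolynomial.X i, ?_⟩
        conv_lhs => rw [hp']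
        rw [map_mul]
        simp only [φ, MvPolynomial.aeval_X, hi, if_false]
        ring
  have h1 := congrArg (fun s => φ (latticeSymEquiv b s)) h
  simp only [map_mul, latticeSymEquiv_basis] at h1
  rw [latticeSymEquiv_symOf b y] at h1
  have h2 : φ (MvPolynomial.X j) = 0 := by simp [φ]
  rw [h2, zero_mul] at h1
  have h3 : φ (∑ i, MvPolynomial.C (b.repr y i : k) * MvPolynomial.X i) =
      ∑ i, MvPolynomial.C (if i = j then 0 else (b.repr y i : k)) * MvPolynomial.X i := by
    rw [map_sum]
    refine Finset.sum_congr rfl fun i _ => ?_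
    rw [map_mul]
    by_cases hi : i = j <;> simp [φ, hi]
  rw [h3] at h1
  have h4 := MvPolynomial.eq_zero_of_linear_mul_eq_zero _ (fun d hd => by
    -- `d` annihilates all coordinates of `y` but the `j`-th one.
    have h5 : d • ((1 : k) ⊗ₜ[ℤ] y) = (d * (b.repr y j : k)) • ((1 : k) ⊗ₜ[ℤ] b j) := by
      have h6 : ((1 : k) ⊗ₜ[ℤ] y) = ∑ i, (b.repr y i : k) • ((1 : k) ⊗ₜ[ℤ] b i) := by
        conv_lhs => rw [← b.sum_repr y]
        rw [TensorProduct.tmul_sum]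
        refine Finset.sum_congr rfl fun i _ => ?_
        rw [TensorProduct.tmul_smul, Int.cast_smul_eq_zsmul]
      rw [h6, Finset.smul_sum, Finset.sum_eq_single j]
      · rw [smul_smul]
      · intro i _ hi
        have := hd i
        rw [if_neg hi] at this
        rw [smul_smul, this, zero_smul]
      · simp
    have h7 := LinearIndependent.pair_iff.1 hy d (-(d * (b.repr y j : k))) (by
      rw [h5, neg_smul, add_neg_cancel])
    exact h7.1) _ h1
  obtain ⟨q, hq⟩ := hφ (latticeSymEquiv b a)
  rw [h4, zero_add] at hq
  refine ⟨(latticeSymEquiv b).symm q, ?_⟩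
  apply (latticeSymEquiv b).injective
  rw [hq, map_mul, latticeSymEquiv_basis, AlgEquiv.apply_symm_apply]

end LatticeSym

/-! ### Divisibility in projective modules -/

section Projective

variable {S : Type*} [CommRing S] {P : Type*} [AddCommGroup P] [Module S P] [Module.Projective S P]

lemma eq_zero_of_smul_eq_zero_of_projective {b : S} (hb : ∀ a, b * a = 0 → a = 0) {m : P}
    (h : b • m = 0) : m = 0 := by
  obtain ⟨s, hs⟩ := Module.projective_def.1 (inferInstance : Module.Projective S P)
  have : s m = 0 := by
    ext i
    apply hb
    rw [← smul_eq_mul, ← Finsupp.smul_apply, ← map_smul, h, map_zero, Finsupp.zero_apply]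
  rw [← hs m, this, map_zero]

/-- If `g` is regular modulo `b` on the ring, it is so on projective modules. -/
lemma exists_eq_smul_of_projective {b g : S} (hg : ∀ a c, g * a = b * c → ∃ d, a = b * d)
    {m p : P} (h : g • m = b • p) : ∃ q, m = b • q := by
  classical
  obtain ⟨s, hs⟩ := Module.projective_def.1 (inferInstance : Module.Projective S P)
  have : ∀ i, ∃ d, s m i = b * d := by
    intro i
    refine hg _ (s p i) ?_
    rw [← smul_eq_mul, ← Finsupp.smul_apply, ← map_smul, h, map_smul, Finsupp.smul_apply,
      smul_eq_mul]
  choose d hd using this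
  refine ⟨Finsupp.linearCombination S id
    (Finsupp.onFinset (s m).support (fun i => if s m i = 0 then 0 else d i) (by simp_all)), ?_⟩
  rw [← map_smul]
  conv_lhs => rw [← hs m]
  congr 1
  ext i
  rw [Finsupp.smul_apply, Finsupp.onFinset_apply]
  split_ifs with h0
  · simp [h0]
  · exact hd i

end Projective

/-! ### Graded modules -/

section Graded

variable {k : Type*} [CommRing k] {Y : Type*} [AddCommGroup Y]

/-- The symmetric algebra is spanned by its homogeneous elements. -/
lemma symGrade_induction {p : LatticeSym k Y → Prop}
    (hom : ∀ i a, a ∈ symGrade k Y i → p a) (add : ∀ a b, p a → p b → p (a + b)) (a) : p a := by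
  let M := LinearMap.range (SymmetricAlgebra.ι k (k ⊗[ℤ] Y))
  have hM : ∀ d : ℕ, ∀ a ∈ M ^ d, a ∈ symGrade k Y (2 * (d : ℤ)) := fun d a ha =>
    Submodule.mem_iSup_of_mem d (Submodule.mem_iSup_of_mem rfl ha)
  have htop : ∀ a, a ∈ ⨆ d : ℕ, M ^ d := by
    intro a
    induction a using SymmetricAlgebra.induction with
    | algebraMap r =>
      refine Submodule.mem_iSup_of_mem 0 ?_
      rw [pow_zero]
      exact Submodule.algebraMap_mem r
    | ι x =>
      refine Submodule.mem_iSup_of_mem 1 ?_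
      rw [pow_one]
      exact ⟨x, rfl⟩
    | mul a b ha hb =>
      induction ha using Submodule.iSup_induction' with
      | mem i x hx =>
        induction hb using Submodule.iSup_induction' with
        | mem j y hy =>
          refine Submodule.mem_iSup_of_mem (i + j) ?_
          rw [pow_add]
          exact Submodule.mul_mem_mul hx hy
        | zero => rw [mul_zero]; exact Submodule.zero_mem _
        | add y z _ _ hy hz => rw [mul_add]; exact Submodule.add_mem _ hy hz
      | zero => rw [zero_mul]; exact Submodule.zero_mem _
      | add y z _ _ hy hz => rw [add_mul]; exact Submodule.add_mem _ hy hz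
    | add a b ha hb => exact Submodule.add_mem _ ha hb
  induction htop a using Submodule.iSup_induction' with
  | mem i x hx => exact hom _ x (hM i x hx)
  | zero => exact hom 0 0 (Submodule.zero_mem _)
  | add x y _ _ hx hy => exact add x y hx hy

namespace GrMod

variable (M N : GrMod.{v} k Y)

/-- The homogeneous component of degree `i`. -/
noncomputable def component (i : ℤ) : M →+ M :=
  letI := M.isInternal.chooseDecomposition
  (M.deg i).subtype.comp
    ((DFinsupp.evalAddMonoidHom i).comp (DirectSum.decomposeAddEquiv M.deg).toAddMonoidHom)

variable {M N}

lemma component_mem (i : ℤ) (m : M) : M.component i m ∈ M.deg i := Subtype.property _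

lemma component_of_mem {i : ℤ} {m : M} (h : m ∈ M.deg i) : M.component i m = m := by
  let := M.isInternal.chooseDecomposition
  exact DirectSum.decompose_of_mem_same M.deg h

lemma component_of_mem_ne {i j : ℤ} {m : M} (h : m ∈ M.deg i) (hij : i ≠ j) :
    M.component j m = 0 := by
  let := M.isInternal.chooseDecomposition
  exact DirectSum.decompose_of_mem_ne M.deg h hij

lemma induction_on {p : M → Prop} (m : M) (zero : p 0) (hom : ∀ i, ∀ m ∈ M.deg i, p m)
    (add : ∀ m m', p m → p m' → p (m + m')) : p m := by
  let := M.isInternal.chooseDecomposition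
  exact DirectSum.Decomposition.inductionOn M.deg zero (fun m => hom _ _ m.2) add m

lemma sum_component (m : M) : ∃ s : Finset ℤ, ∑ i ∈ s, M.component i m = m := by
  classical
  let := M.isInternal.chooseDecomposition
  exact ⟨_, DirectSum.sum_support_decompose M.deg m⟩

lemma mem_deg_of_component {i : ℤ} {m : M} (h : ∀ j, j ≠ i → M.component j m = 0) :
    m ∈ M.deg i := by
  obtain ⟨s, hs⟩ := M.sum_component m
  rw [← hs]
  refine sum_mem fun j _ => ?_
  by_cases hj : j = i
  · rw [hj]; exact component_mem i m
  · rw [h j hj]; exact zero_mem _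

lemma component_smul {j : ℤ} {a : LatticeSym k Y} (ha : a ∈ symGrade k Y j) (i : ℤ) (m : M) :
    M.component (j + i) (a • m) = a • M.component i m := by
  induction m using GrMod.induction_on with
  | zero => simp
  | hom l m hm =>
    have h := M.smul_mem j l a m ha hm
    by_cases hl : l = i
    · subst hl
      rw [component_of_mem hm, component_of_mem h]
    · rw [component_of_mem_ne hm hl, smul_zero, component_of_mem_ne h (by omega)]
  | add m m' hm hm' => rw [smul_add, map_add, hm, hm', map_add, smul_add]

lemma component_map {f : M →ₗ[LatticeSym k Y] N} (hf : ∀ i, ∀ m ∈ M.deg i, f m ∈ N.deg i)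
    (i : ℤ) (m : M) : N.component i (f m) = f (M.component i m) := by
  induction m using GrMod.induction_on with
  | zero => simp
  | hom l m hm =>
    by_cases hl : l = i
    · subst hl
      rw [component_of_mem hm, component_of_mem (hf _ _ hm)]
    · rw [component_of_mem_ne hm hl, map_zero, component_of_mem_ne (hf _ _ hm) hl]
  | add m m' hm hm' => rw [map_add, map_add, hm, hm', map_add, map_add]

/-- The degree zero part of a linear map, as an additive map: on the component of degree `i` it is the
degree `i` component of the given map. -/
noncomputable def gradedPartAux (f : M →ₗ[LatticeSym k Y] N) : M →+ N :=
  letI := M.isInternal.chooseDecomposition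
  (DirectSum.toAddMonoid fun i =>
    (N.component i).comp (f.toAddMonoidHom.comp (M.deg i).subtype)).comp
    (DirectSum.decomposeAddEquiv M.deg).toAddMonoidHom

lemma gradedPartAux_of_mem (f : M →ₗ[LatticeSym k Y] N) {i : ℤ} {m : M} (hm : m ∈ M.deg i) :
    gradedPartAux f m = N.component i (f m) := by
  let := M.isInternal.chooseDecomposition
  change DirectSum.toAddMonoid _ (DirectSum.decompose M.deg m) = _
  rw [DirectSum.decompose_of_mem M.deg hm, DirectSum.toAddMonoid_of]
  rfl

/-- The degree zero part of a linear map between graded modules. -/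
noncomputable def gradedPart (f : M →ₗ[LatticeSym k Y] N) : GrHom M N where
  toFun := gradedPartAux f
  map_add' := map_add _
  map_smul' a m := by
    induction m using GrMod.induction_on with
    | zero => simp
    | hom i m hm =>
      induction a using symGrade_induction with
      | hom j a ha =>
        rw [gradedPartAux_of_mem f (M.smul_mem j i a m ha hm), gradedPartAux_of_mem f hm, map_smul,
          component_smul ha]
        rfl
      | add a b ha hb =>
        rw [add_smul, map_add, ha, hb]
        exact (add_smul a b _).symm
    | add m m' hm hm' => rw [smul_add, map_add, hm, hm', map_add, smul_add]
  map_mem i m hm := by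
    change gradedPartAux f m ∈ _
    rw [gradedPartAux_of_mem f hm]
    exact component_mem _ _

lemma gradedPart_of_mem (f : M →ₗ[LatticeSym k Y] N) {i : ℤ} {m : M} (hm : m ∈ M.deg i) :
    (gradedPart f).toLinearMap m = N.component i (f m) := gradedPartAux_of_mem f hm

lemma IsHomogeneous.component_mem {L : Submodule (LatticeSym k Y) M} (hL : M.IsHomogeneous L)
    (i : ℤ) {m : M} (hm : m ∈ L) : M.component i m ∈ L := by
  have hm' := hm
  rw [hL] at hm'
  induction hm' using Submodule.span_induction generalizing i with
  | mem x hx =>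
    obtain ⟨hx, j, hj⟩ := hx
    by_cases hij : j = i
    · subst hij
      rwa [component_of_mem hj]
    · rw [component_of_mem_ne hj hij]
      exact L.zero_mem
  | zero => rw [map_zero]; exact L.zero_mem
  | add x y hx hy hx' hy' =>
    rw [map_add]
    exact L.add_mem (hx' i (by rw [hL]; exact hx)) (hy' i (by rw [hL]; exact hy))
  | smul a x hx hx' =>
    have hx'' : x ∈ L := by rw [hL]; exact hx
    clear hm
    induction a using symGrade_induction generalizing i with
    | hom j a ha =>
      have := component_smul ha (i - j) x
      rw [add_sub_cancel] at this
      rw [this]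
      exact L.smul_mem _ (hx' _ hx'')
    | add a b ha hb =>
      rw [add_smul, map_add]
      exact L.add_mem (ha i) (hb i)

lemma isHomogeneous_range (f : GrHom M N) : N.IsHomogeneous (LinearMap.range f.toLinearMap) := by
  refine le_antisymm ?_ (Submodule.span_le.2 fun m hm => hm.1)
  rintro _ ⟨m, rfl⟩
  induction m using GrMod.induction_on with
  | zero => rw [map_zero]; exact Submodule.zero_mem _
  | hom i m hm => exact Submodule.subset_span ⟨⟨m, rfl⟩, i, f.map_mem i m hm⟩
  | add m m' hm hm' => rw [map_add]; exact Submodule.add_mem _ hm hm'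

end GrMod

/-! ### Isomorphisms of graded modules -/

namespace GrIso

variable {M N P : GrMod.{v} k Y}

/-- A bijective map of degree zero is an isomorphism of graded modules. -/
noncomputable def ofBijective (f : GrHom M N) (hf : Function.Bijective f.toLinearMap) :
    GrIso M N where
  toLinearEquiv := LinearEquiv.ofBijective f.toLinearMap hf
  map_mem_iff i m := by
    refine ⟨fun h => GrMod.mem_deg_of_component fun j hj => hf.1 ?_, f.map_mem i m⟩
    rw [map_zero, ← GrMod.component_map f.map_mem]
    exact GrMod.component_of_mem_ne h hj.symm

/-- The identity. -/
def refl (M : GrMod.{v} k Y) : GrIso M M where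
  toLinearEquiv := LinearEquiv.refl _ _
  map_mem_iff _ _ := Iff.rfl

/-- The inverse. -/
def symm (e : GrIso M N) : GrIso N M where
  toLinearEquiv := e.toLinearEquiv.symm
  map_mem_iff i m := by rw [← e.map_mem_iff, LinearEquiv.apply_symm_apply]

@[simp] lemma symm_toLinearEquiv (e : GrIso M N) :
    e.symm.toLinearEquiv = e.toLinearEquiv.symm := rfl

lemma component_map (e : GrIso M N) (i : ℤ) (m : M) :
    N.component i (e.toLinearEquiv m) = e.toLinearEquiv (M.component i m) :=
  GrMod.component_map (f := e.toLinearEquiv.toLinearMap) (fun i m hm => (e.map_mem_iff i m).2 hm) i m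

/-- Isomorphisms descend to quotients by corresponding kernels. -/
lemma exists_of_surjective {M' N' : GrMod.{v} k Y} (e : GrIso M N) (π : GrHom M M')
    (π' : GrHom N N') (hπ : Function.Surjective π.toLinearMap)
    (hπ' : Function.Surjective π'.toLinearMap)
    (hker : ∀ m, π.toLinearMap m = 0 ↔ π'.toLinearMap (e.toLinearEquiv m) = 0) :
    ∃ e' : GrIso M' N',
      ∀ m, e'.toLinearEquiv (π.toLinearMap m) = π'.toLinearMap (e.toLinearEquiv m) := by
  let q : M' ≃ₗ[LatticeSym k Y] N' :=
    (π.toLinearMap.quotKerEquivOfSurjective hπ).symm ≪≫ₗ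
      Submodule.Quotient.equiv _ (LinearMap.ker π'.toLinearMap) e.toLinearEquiv (by
        ext x
        obtain ⟨m, rfl⟩ := e.toLinearEquiv.surjective x
        simp [hker]) ≪≫ₗ
      π'.toLinearMap.quotKerEquivOfSurjective hπ'
  have hq : ∀ m, q (π.toLinearMap m) = π'.toLinearMap (e.toLinearEquiv m) := by
    intro m
    have : (π.toLinearMap.quotKerEquivOfSurjective hπ).symm (π.toLinearMap m) =
        Submodule.Quotient.mk m := by
      rw [LinearEquiv.symm_apply_eq]; rfl
    simp only [q, LinearEquiv.trans_apply, this]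
    rfl
  refine ⟨ofBijective ⟨q.toLinearMap, fun i m hm => ?_⟩ q.bijective, hq⟩
  obtain ⟨m, rfl⟩ := hπ m
  rw [← GrMod.component_of_mem hm, GrMod.component_map π.map_mem]
  change q _ ∈ _
  rw [hq]
  exact π'.map_mem _ _ ((e.map_mem_iff _ _).2 (GrMod.component_mem _ _))

end GrIso

/-! ### Uniqueness of projective covers -/

variable {P Q : GrMod.{v} k Y}

/-- The lifting half of the uniqueness of projective covers: a graded relation `Z` that is total on a
projective module `P` contains the graph of a map of degree zero, and this map is surjective if `Z`
is essential over `Q`. -/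
lemma exists_surjective_grHom_of_relation (hP : Module.Projective (LatticeSym k Y) P)
    (Z : Submodule (LatticeSym k Y) (P × Q))
    (hZ : ∀ p q, (p, q) ∈ Z → ∀ i, (P.component i p, Q.component i q) ∈ Z)
    (hZP : ∀ p, ∃ q, (p, q) ∈ Z)
    (hQ : ∀ L : Submodule (LatticeSym k Y) Q, Q.IsHomogeneous L →
      (∀ p, ∃ q ∈ L, (p, q) ∈ Z) → L = ⊤) :
    ∃ f : GrHom P Q, (∀ p, (p, f.toLinearMap p) ∈ Z) ∧ Function.Surjective f.toLinearMap := by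
  obtain ⟨h, hh⟩ := Module.projective_lifting_property
    ((LinearMap.fst (LatticeSym k Y) P Q).comp Z.subtype) LinearMap.id (fun p => by
      obtain ⟨q, hq⟩ := hZP p
      exact ⟨⟨(p, q), hq⟩, rfl⟩)
  let g : P →ₗ[LatticeSym k Y] Q := ((LinearMap.snd (LatticeSym k Y) P Q).comp Z.subtype).comp h
  have hg : ∀ p, (p, g p) ∈ Z := by
    intro p
    have h1 : (h p : P × Q).1 = p := LinearMap.congr_fun hh p
    have h2 : (p, g p) = (h p : P × Q) := Prod.ext h1.symm rfl
    rw [h2]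
    exact (h p).2
  have hgZ : ∀ p, (p, (GrMod.gradedPart g).toLinearMap p) ∈ Z := by
    intro p
    induction p using GrMod.induction_on with
    | zero => rw [map_zero]; exact Z.zero_mem
    | hom i p hp =>
      rw [GrMod.gradedPart_of_mem g hp]
      have := hZ _ _ (hg p) i
      rwa [GrMod.component_of_mem hp] at this
    | add p p' hp hp' => rw [map_add]; exact Z.add_mem hp hp'
  refine ⟨GrMod.gradedPart g, hgZ, LinearMap.range_eq_top.1 ?_⟩
  exact hQ _ (GrMod.isHomogeneous_range _) fun p => ⟨_, ⟨p, rfl⟩, hgZ p⟩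

/-- Uniqueness of projective covers in relational form: if a graded relation between two
projective modules is total and essential in both directions, then it contains the graph of an
isomorphism. -/
lemma exists_grIso_of_relation (hP : Module.Projective (LatticeSym k Y) P)
    (hQ : Module.Projective (LatticeSym k Y) Q) (Z : Submodule (LatticeSym k Y) (P × Q))
    (hZ : ∀ p q, (p, q) ∈ Z → ∀ i, (P.component i p, Q.component i q) ∈ Z)
    (hZP : ∀ p, ∃ q, (p, q) ∈ Z) (hZQ : ∀ q, ∃ p, (p, q) ∈ Z)
    (hP' : ∀ L : Submodule (LatticeSym k Y) P, P.IsHomogeneous L →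
      (∀ q, ∃ p ∈ L, (p, q) ∈ Z) → L = ⊤)
    (hQ' : ∀ L : Submodule (LatticeSym k Y) Q, Q.IsHomogeneous L →
      (∀ p, ∃ q ∈ L, (p, q) ∈ Z) → L = ⊤) :
    ∃ e : GrIso P Q, ∀ p, (p, e.toLinearEquiv p) ∈ Z := by
  -- There are surjections in both directions, and surjective endomorphisms of finitely generated
  -- modules are injective.
  obtain ⟨f, hf, hfs⟩ := exists_surjective_grHom_of_relation hP Z hZ hZP hQ'
  obtain ⟨g, -, hgs⟩ := exists_surjective_grHom_of_relation hQ
    (Z.comap ((LinearMap.snd _ Q P).prod (LinearMap.fst _ Q P)))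
    (fun q p h i => hZ p q h i) hZQ hP'
  have hinj : Function.Injective (g.toLinearMap.comp f.toLinearMap) :=
    OrzechProperty.injective_of_surjective_endomorphism _ (by
      rw [LinearMap.coe_comp]; exact hgs.comp hfs)
  rw [LinearMap.coe_comp] at hinj
  exact ⟨GrIso.ofBijective f ⟨hinj.of_comp, hfs⟩, hf⟩

/-- In the free module of rank one, a graded submodule is everything as soon as it is so modulo an
element of `Y_k`. -/
lemma eq_top_of_equiv_symAlgebra {e : P ≃ₗ[LatticeSym k Y] LatticeSym k Y}
    (he : ∀ (i : ℤ) (m : P), m ∈ P.deg i ↔ e m ∈ symGrade k Y i) (y : Y)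
    {L : Submodule (LatticeSym k Y) P} (hL : P.IsHomogeneous L)
    (h : ∀ m, ∃ m' ∈ L, ∃ p, m = m' + symOf k y • p) : L = ⊤ := by
  have h1 : e.symm 1 ∈ P.deg 0 := by
    rw [he, LinearEquiv.apply_symm_apply]
    refine Submodule.mem_iSup_of_mem 0 (Submodule.mem_iSup_of_mem (by simp) ?_)
    rw [pow_zero]
    exact Submodule.one_le.1 le_rfl
  have hy : symOf k y ∈ symGrade k Y 2 := by
    refine Submodule.mem_iSup_of_mem 1 (Submodule.mem_iSup_of_mem (by simp) ?_)
    rw [pow_one]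
    exact ⟨_, rfl⟩
  obtain ⟨m', hm', p, hp⟩ := h (e.symm 1)
  -- There is nothing in degree `-2`.
  have h2 : P.component (-2) p = 0 := by
    have h3 := (he (-2) _).1 (GrMod.component_mem (-2) p)
    have h4 : symGrade k Y (-2) = ⊥ := by
      refine iSup_eq_bot.2 fun d => iSup_eq_bot.2 fun hd => ?_
      omega
    rw [h4, Submodule.mem_bot] at h3
    exact (LinearEquiv.map_eq_zero_iff e).1 h3
  have h5 : e.symm 1 ∈ L := by
    have h6 := congrArg (P.component 0) hp
    have h7 := GrMod.component_smul hy (-2) p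
    rw [show (2 : ℤ) + -2 = 0 by norm_num, h2, smul_zero] at h7
    rw [GrMod.component_of_mem h1, map_add, h7, add_zero] at h6
    rw [h6]
    exact hL.component_mem 0 hm'
  rw [eq_top_iff]
  intro m _
  have : m = e m • e.symm 1 := by
    apply e.injective
    rw [map_smul, LinearEquiv.apply_symm_apply, smul_eq_mul, mul_one]
  rw [this]
  exact L.smul_mem _ h5

end Graded

/-! ### Sections of Braden–MacPherson sheaves -/

namespace MomentGraph

variable {V : Type*} [PartialOrder V] {Y : Type*} [AddCommGroup Y] {G : MomentGraph V Y}

lemma Edge.eq_of_src_tgt {E E' : G.Edge} (hs : E.src = E'.src) (ht : E.tgt = E'.tgt) : E = E' := by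
  obtain ⟨u, v, h⟩ := E
  obtain ⟨u', v', h'⟩ := E'
  obtain rfl : u = u' := hs
  obtain rfl : v = v' := ht
  rfl

lemma Edge.src_lt_tgt (E : G.Edge) : E.src < E.tgt := G.lt_of_adj E.adj

end MomentGraph

namespace KSheaf

variable {k : Type*} [CommRing k] {V : Type*} [PartialOrder V] {Y : Type*} [AddCommGroup Y]
  {G : MomentGraph V Y}

/-- A family of elements of all stalks restricts to a section over `J`. Only the sources of the edges
are required to lie in `J`, which is the right condition for upper sets. -/
def IsSectionOn (B : KSheaf.{v} k G) (J : Set V) (γ : ∀ x, B.stalk x) : Prop :=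
  ∀ E : G.Edge, E.src ∈ J →
    B.rho E.src E (Or.inl rfl) (γ E.src) = B.rho E.tgt E (Or.inr rfl) (γ E.tgt)

lemma IsSectionOn.mono {B : KSheaf.{v} k G} {J J' : Set V} {γ : ∀ x, B.stalk x}
    (h : B.IsSectionOn J γ) (hJ : J' ⊆ J) : B.IsSectionOn J' γ := fun E hE => h E (hJ hE)

lemma component_rho (B : KSheaf.{v} k G) {x : V} {E : G.Edge} (h : E.Incident x) (i : ℤ)
    (m : B.stalk x) :
    (B.edge E).component i (B.rho x E h m) = B.rho x E h ((B.stalk x).component i m) :=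
  GrMod.component_map (B.res x E h).map_mem i m

/-- Elements of `Y` that agree modulo the label of an edge act in the same way on its module. -/
lemma smul_eq_smul_of_label (B : KSheaf.{v} k G) {E : G.Edge} {c c' : Y} {n : ℤ}
    (h : c' = c + n • E.label) (m : B.edge E) : symOf k c' • m = symOf k c • m := by
  rw [h, symOf_add, symOf_zsmul, add_smul, smul_assoc, B.label_smul, smul_zero, add_zero]

namespace IsBradenMacPherson

variable [OrderTop V] {B : KSheaf.{v} k G}

lemma rho_eq_zero_iff (hB : B.IsBradenMacPherson) {E : G.Edge} {y : V} (h : E.tgt = y)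
    (m : B.stalk y) :
    B.rho y E (Or.inr h) m = 0 ↔ ∃ m' : B.stalk y, m = symOf k E.label • m' := by
  subst h
  exact hB.rho_tgt_ker E m

lemma projective (hB : B.IsBradenMacPherson) (hG : ∀ x : V, x ≠ ⊤ → Nonempty (G.OutEdge x))
    (x : V) : Module.Projective (LatticeSym k Y) (B.stalk x) := by
  by_cases hx : x = ⊤
  · subst hx
    obtain ⟨e, -⟩ := hB.stalk_top
    exact Module.Projective.of_equiv e.symm
  · exact (hB.cover x (hG x hx)).1

/-- A section over the elements above `x` is matched by an element of the stalk at `x`. -/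
lemma exists_stalk_of_section (hB : B.IsBradenMacPherson) {x : V} {γ : ∀ x, B.stalk x}
    (hγ : B.IsSectionOn (Set.Ioi x) γ) :
    ∃ m : B.stalk x, ∀ (E : G.Edge) (h : E.src = x),
      B.rho x E (Or.inl h) m = B.rho E.tgt E (Or.inr rfl) (γ E.tgt) := by
  by_cases hx : Nonempty (G.OutEdge x)
  · have h1 : B.uMap x (fun y => γ y) ∈ B.deltaStalk x :=
      ⟨fun y => γ y, fun E hs ht => hγ E hs, rfl⟩
    rw [← (hB.cover x hx).2.1] at h1
    obtain ⟨m, hm⟩ := h1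
    exact ⟨m, fun E h => congrFun hm ⟨E, h⟩⟩
  · exact ⟨0, fun E h => absurd ⟨⟨E, h⟩⟩ hx⟩

/-- Braden–MacPherson sheaves are flabby: sections over upper sets extend to global sections. -/
lemma exists_extension [Finite V] (hB : B.IsBradenMacPherson) {J : Set V} (hJ : IsUpperSet J)
    {γ : ∀ x, B.stalk x} (hγ : B.IsSectionOn J γ) :
    ∃ γ' : ∀ x, B.stalk x, B.IsSectionOn Set.univ γ' ∧ ∀ x ∈ J, γ' x = γ x := by
  classical
  induction hn : Jᶜ.ncard using Nat.strong_induction_on generalizing J γ with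
  | _ n ih =>
  by_cases hne : Jᶜ.Nonempty
  · obtain ⟨x, hx⟩ := (Set.toFinite Jᶜ).exists_maximal hne
    have habove : ∀ y, x < y → y ∈ J := fun y hy => by
      by_contra h
      exact hx.not_gt h hy
    obtain ⟨m, hm⟩ := hB.exists_stalk_of_section (hγ.mono (J' := Set.Ioi x) habove)
    have hJ' : IsUpperSet (insert x J) := by
      intro a b hab ha
      rcases ha with rfl | ha
      · rcases hab.eq_or_lt with rfl | h
        · exact Or.inl rfl
        · exact Or.inr (habove _ h)
      · exact Or.inr (hJ hab ha)
    have hsec : B.IsSectionOn (insert x J) (Function.update γ x m) := by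
      intro E hE
      by_cases hEx : E.src = x
      · have htx : E.tgt ≠ x := by rw [← hEx]; exact E.src_lt_tgt.ne'
        rw [Function.update_of_ne htx, ← hm E hEx]
        subst hEx
        rw [Function.update_self]
      · have hEJ : E.src ∈ J := hE.resolve_left hEx
        have htx : E.tgt ≠ x := by
          rintro rfl
          exact hx.prop (hJ E.src_lt_tgt.le hEJ)
        rw [Function.update_of_ne htx, Function.update_of_ne hEx]
        exact hγ E hEJ
    have hlt : (insert x J)ᶜ.ncard < n := by
      rw [← hn]
      refine Set.ncard_lt_ncard ?_ (Set.toFinite _)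
      refine ⟨Set.compl_subset_compl.2 (Set.subset_insert x J), fun h => ?_⟩
      exact h hx.prop (Or.inl rfl)
    obtain ⟨γ', h1, h2⟩ := ih _ hlt hJ' hsec rfl
    refine ⟨γ', h1, fun y hy => ?_⟩
    rw [h2 y (Or.inr hy), Function.update_of_ne]
    rintro rfl
    exact hx.prop hy
  · rw [Set.not_nonempty_iff_eq_empty, Set.compl_empty_iff] at hne
    subst hne
    exact ⟨γ, hγ, fun _ _ => rfl⟩

/-- An element of the stalk at `x` is matched by a global section. -/
lemma exists_section_of_stalk [Finite V] (hB : B.IsBradenMacPherson) {x : V} (m : B.stalk x) :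
    ∃ γ : ∀ x, B.stalk x, B.IsSectionOn Set.univ γ ∧ ∀ (E : G.Edge) (h : E.src = x),
      B.rho x E (Or.inl h) m = B.rho E.tgt E (Or.inr rfl) (γ E.tgt) := by
  classical
  by_cases hx : Nonempty (G.OutEdge x)
  · have h1 : B.dMap x m ∈ LinearMap.range (B.dMap x) := ⟨m, rfl⟩
    rw [(hB.cover x hx).2.1] at h1
    obtain ⟨μ, hμ, hu⟩ := h1
    have hsec : B.IsSectionOn (Set.Ioi x) fun y => if h : x < y then μ ⟨y, h⟩ else 0 := by
      intro E hE
      have hs : x < E.src := hE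
      have ht : x < E.tgt := hs.trans E.src_lt_tgt
      simp only [dif_pos hs, dif_pos ht]
      exact hμ E hs ht
    obtain ⟨γ, hγ, hγ'⟩ := hB.exists_extension (isUpperSet_Ioi x) hsec
    refine ⟨γ, hγ, fun E h => ?_⟩
    have ht : x < E.tgt := by rw [← h]; exact E.src_lt_tgt
    rw [hγ' E.tgt ht, dif_pos ht]
    exact (congrFun hu ⟨E, h⟩).symm
  · exact ⟨0, fun E _ => by simp, fun E h => absurd ⟨⟨E, h⟩⟩ hx⟩

end IsBradenMacPherson

end KSheaf

/-! ### Folding symmetries of moment graphs -/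

/-- The properties of right multiplication by a simple reflection on a Bruhat graph that are
responsible for the symmetry of Braden–MacPherson sheaves: a fixed point free involution `s` of the
vertices that preserves all labels, maps edges to edges and reverses only the "vertical" edges
between `x` and `s x`, together with a section `c` of the structure algebra that is anti-invariant
under `s` and whose value at `x` is, up to sign, the label of the vertical edge at `x`.
The function `level` is constant on pairs `{x, s x}` and increases along the other relations. -/
structure MomentGraph.FoldingSymmetry (k : Type*) [CommRing k] {V : Type*} [PartialOrder V]
    [OrderTop V] {Y : Type*} [AddCommGroup Y] (G : MomentGraph V Y) where
  /-- the involution -/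
  s : V → V
  s_s : ∀ x, s (s x) = x
  /-- a rank function on the pairs `{x, s x}` -/
  level : V → ℕ
  level_s : ∀ x, level (s x) = level x
  eq_or_level_lt : ∀ {x y}, x < y → y = s x ∨ level x < level y
  adj_vertical : ∀ x, G.Adj x (s x) ∨ G.Adj (s x) x
  adj_s : ∀ {x y} (h : G.Adj x y), y = s x ∨ ∃ h' : G.Adj (s x) (s y), G.label h' = G.label h
  /-- the anti-invariant section of the structure algebra -/
  c : V → Y
  c_s : ∀ x, c (s x) = -c x
  label_vertical : ∀ {x y} (h : G.Adj x y), y = s x → G.label h = c y ∨ G.label h = -c y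
  c_adj : ∀ {x y} (h : G.Adj x y), ∃ n : ℤ, c y = c x + n • G.label h
  exists_outEdge : ∀ x, x ≠ ⊤ → Nonempty (G.OutEdge x)
  label_regular : ∀ {x y} (h : G.Adj x y) (a : LatticeSym k Y),
    symOf k (G.label h) * a = 0 → a = 0
  label_regular_mod : ∀ E E' : G.Edge, E ≠ E' → (∃ x, E.Incident x ∧ E'.Incident x) →
    ∀ a b : LatticeSym k Y, symOf k E.label * a = symOf k E'.label * b →
      ∃ d, a = symOf k E'.label * d

namespace MomentGraph.FoldingSymmetry

variable {k : Type*} [CommRing k] {V : Type*} [PartialOrder V] [OrderTop V] {Y : Type*}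
  [AddCommGroup Y] {G : MomentGraph V Y} (D : G.FoldingSymmetry k)

lemma eq_s_comm {x y : V} : y = D.s x ↔ x = D.s y := by
  constructor <;> rintro rfl <;> rw [D.s_s]

/-- The edge `E'` is the translate of the edge `E`, in the same direction. -/
def Parallel (E E' : G.Edge) : Prop := E'.src = D.s E.src ∧ E'.tgt = D.s E.tgt

variable {D}

lemma Parallel.symm {E E' : G.Edge} (h : D.Parallel E E') : D.Parallel E' E :=
  ⟨D.eq_s_comm.1 h.1, D.eq_s_comm.1 h.2⟩

lemma Parallel.tgt_ne {E E' : G.Edge} (h : D.Parallel E E') : E.tgt ≠ D.s E.src := by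
  intro h'
  have h1 := E'.src_lt_tgt
  rw [h.1, h.2, h', D.s_s, ← h'] at h1
  exact lt_asymm h1 E.src_lt_tgt

lemma level_lt_of_ne {E : G.Edge} (h : E.tgt ≠ D.s E.src) : D.level E.src < D.level E.tgt :=
  (D.eq_or_level_lt E.src_lt_tgt).resolve_left h

lemma exists_parallel {E : G.Edge} (h : E.tgt ≠ D.s E.src) : ∃ E', D.Parallel E E' := by
  obtain ⟨h', -⟩ := (D.adj_s E.adj).resolve_left h
  exact ⟨⟨_, _, h'⟩, rfl, rfl⟩

lemma Parallel.label_eq {E E' : G.Edge} (h : D.Parallel E E') : E'.label = E.label := by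
  obtain ⟨h', hl⟩ := (D.adj_s E.adj).resolve_left h.tgt_ne
  have : E' = ⟨_, _, h'⟩ := Edge.eq_of_src_tgt h.1 h.2
  rw [this]
  exact hl

lemma level_eq {x y : V} (h : y = D.s x) : D.level y = D.level x := by rw [h, D.level_s]

variable (D)

lemma level_mono : Monotone D.level := by
  intro x y h
  rcases h.eq_or_lt with rfl | h
  · exact le_rfl
  · rcases D.eq_or_level_lt h with rfl | h
    · exact (D.level_s x).ge
    · exact h.le

/-- The vertical edge at `x`. -/
lemma exists_vertical (x : V) : ∃ E : G.Edge, E.Incident x ∧ E.tgt = D.s E.src ∧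
    (E.label = D.c x ∨ E.label = -D.c x) := by
  rcases D.adj_vertical x with h | h
  · refine ⟨⟨_, _, h⟩, Or.inl rfl, rfl, ?_⟩
    have := D.label_vertical h rfl
    rw [D.c_s, neg_neg] at this
    exact this.symm
  · exact ⟨⟨_, _, h⟩, Or.inr rfl, (D.s_s x).symm, D.label_vertical h (D.s_s x).symm⟩

/-- The section `c` takes regular values. -/
lemma c_regular (x : V) (a : LatticeSym k Y) (h : symOf k (D.c x) * a = 0) : a = 0 := by
  obtain ⟨E, -, -, hE⟩ := D.exists_vertical x
  refine D.label_regular E.adj a ?_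
  change symOf k E.label * a = 0
  rcases hE with hE | hE
  · rw [hE, h]
  · rw [hE, symOf_neg, neg_mul, h, neg_zero]

/-- The values of the section `c` are regular modulo the labels of the edges that are not
vertical. -/
lemma c_regular_mod {x : V} {E : G.Edge} (hE : E.tgt ≠ D.s E.src) (hx : E.Incident x)
    (a b : LatticeSym k Y) (h : symOf k (D.c x) * a = symOf k E.label * b) :
    ∃ d, a = symOf k E.label * d := by
  obtain ⟨E', hx', hv, hl⟩ := D.exists_vertical x
  have hne : E' ≠ E := by rintro rfl; exact hE hv
  rcases hl with hl | hl
  · exact D.label_regular_mod E' E hne ⟨x, hx', hx⟩ a b (by rw [hl, h])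
  · exact D.label_regular_mod E' E hne ⟨x, hx', hx⟩ a (-b) (by
      rw [hl, symOf_neg, neg_mul, h, mul_neg])

variable (B : KSheaf.{v} k G)

/-- An involutive system of isomorphisms `B^y ≅ B^{s y}` over the vertices of level at least `n`,
compatible with the restriction maps to the edges. On non-vertical edges the induced isomorphism
of edge modules is not part of the data, on vertical edges it is the identity. -/
structure PartialIso (n : ℕ) where
  /-- the isomorphisms of the stalks -/
  φ : ∀ y y' : V, y' = D.s y → n ≤ D.level y → GrIso (B.stalk y) (B.stalk y')
  φ_φ : ∀ (y y' : V) (h : y' = D.s y) (h' : y = D.s y') (hn : n ≤ D.level y)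
    (hn' : n ≤ D.level y') (m : B.stalk y),
    (φ y' y h' hn').toLinearEquiv ((φ y y' h hn).toLinearEquiv m) = m
  parallel : ∀ (E E' : G.Edge) (h : D.Parallel E E') (hs : n ≤ D.level E.src)
    (ht : n ≤ D.level E.tgt) (m : B.stalk E.src) (p : B.stalk E.tgt),
    B.rho E.src E (Or.inl rfl) m = B.rho E.tgt E (Or.inr rfl) p ↔
      B.rho E'.src E' (Or.inl rfl) ((φ _ _ h.1 hs).toLinearEquiv m) =
        B.rho E'.tgt E' (Or.inr rfl) ((φ _ _ h.2 ht).toLinearEquiv p)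
  vertical : ∀ (E : G.Edge) (h : E.tgt = D.s E.src) (hn : n ≤ D.level E.src)
    (m : B.stalk E.src),
    B.rho E.tgt E (Or.inr rfl) ((φ _ _ h hn).toLinearEquiv m) = B.rho E.src E (Or.inl rfl) m

variable {D B}

namespace PartialIso

variable {n : ℕ} (Φ : D.PartialIso B n)

/-- The isomorphism induced on the edge modules by the isomorphism of the stalks at the
targets. -/
lemma exists_edgeIso (hB : B.IsBradenMacPherson) {E E' : G.Edge} (h : D.Parallel E E')
    (ht : n ≤ D.level E.tgt) :
    ∃ ψ : GrIso (B.edge E) (B.edge E'), ∀ m : B.stalk E.tgt,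
      ψ.toLinearEquiv (B.rho E.tgt E (Or.inr rfl) m) =
        B.rho E'.tgt E' (Or.inr rfl) ((Φ.φ _ _ h.2 ht).toLinearEquiv m) := by
  refine GrIso.exists_of_surjective (Φ.φ _ _ h.2 ht) (B.res E.tgt E (Or.inr rfl))
    (B.res E'.tgt E' (Or.inr rfl)) (hB.rho_tgt_surjective E) (hB.rho_tgt_surjective E') fun m => ?_
  refine (hB.rho_tgt_ker E m).trans (Iff.trans ?_ (hB.rho_tgt_ker E' _).symm)
  rw [h.label_eq]
  constructor
  · rintro ⟨m', rfl⟩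
    exact ⟨(Φ.φ _ _ h.2 ht).toLinearEquiv m', map_smul _ _ _⟩
  · rintro ⟨m', hm'⟩
    refine ⟨(Φ.φ _ _ h.2 ht).toLinearEquiv.symm m', ?_⟩
    rw [← map_smul, ← hm', LinearEquiv.symm_apply_apply]

lemma vertical_symm (E : G.Edge) (h : E.src = D.s E.tgt) (hn : n ≤ D.level E.tgt)
    (m : B.stalk E.tgt) :
    B.rho E.src E (Or.inl rfl) ((Φ.φ _ _ h hn).toLinearEquiv m) = B.rho E.tgt E (Or.inr rfl) m := by
  have hn' : n ≤ D.level E.src := by rwa [level_eq h]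
  rw [← Φ.vertical E (D.eq_s_comm.1 h) hn', Φ.φ_φ]

open Classical in
/-- The action of the symmetry on families of elements of the stalks, with value zero below level
`n`. -/
noncomputable def twist (γ : ∀ x, B.stalk x) (x : V) : B.stalk x :=
  if h : n ≤ D.level (D.s x) then (Φ.φ (D.s x) x (D.s_s x).symm h).toLinearEquiv (γ (D.s x)) else 0

lemma twist_apply (γ : ∀ x, B.stalk x) {x x' : V} (h : x = D.s x') (hn : n ≤ D.level x') :
    Φ.twist γ x = (Φ.φ x' x h hn).toLinearEquiv (γ x') := by
  obtain rfl : x' = D.s x := D.eq_s_comm.1 h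
  rw [twist, dif_pos hn]

lemma isSectionOn_twist {γ : ∀ x, B.stalk x} (hγ : B.IsSectionOn {x | n ≤ D.level x} γ) :
    B.IsSectionOn {x | n ≤ D.level x} (Φ.twist γ) := by
  intro E hE
  have hE' : n ≤ D.level E.tgt := le_trans hE (D.level_mono E.src_lt_tgt.le)
  by_cases hv : E.tgt = D.s E.src
  · have hv' := D.eq_s_comm.1 hv
    rw [Φ.twist_apply γ hv hE, Φ.twist_apply γ hv' hE', Φ.vertical E hv hE,
      Φ.vertical_symm E hv' hE', hγ E hE]
  · obtain ⟨E', h⟩ := exists_parallel hv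
    have hs : n ≤ D.level E'.src := by rw [level_eq h.1]; exact hE
    have ht : n ≤ D.level E'.tgt := by rwa [level_eq h.2]
    rw [Φ.twist_apply γ h.symm.1 hs, Φ.twist_apply γ h.symm.2 ht]
    exact (Φ.parallel E' E h.symm hs ht _ _).1 (hγ E' hs)

/-- The difference of a section and its twist is divisible by the anti-invariant section `c`, and
the quotient is again a section. -/
lemma exists_section_of_sub_twist (hB : B.IsBradenMacPherson) {γ : ∀ x, B.stalk x}
    (hγ : B.IsSectionOn {x | n ≤ D.level x} γ) :
    ∃ ν : ∀ x, B.stalk x, B.IsSectionOn {x | n ≤ D.level x} ν ∧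
      ∀ x, n ≤ D.level x → γ x - Φ.twist γ x = symOf k (D.c x) • ν x := by
  have hproj := hB.projective D.exists_outEdge
  have hanti : ∀ x x' (h : x' = D.s x) (hn : n ≤ D.level x), γ x' - Φ.twist γ x' =
      -(Φ.φ x x' h hn).toLinearEquiv (γ x - Φ.twist γ x) := by
    intro x x' h hn
    have hn' : n ≤ D.level x' := by rwa [level_eq h]
    rw [Φ.twist_apply γ h hn, Φ.twist_apply γ (D.eq_s_comm.1 h) hn', map_sub, Φ.φ_φ]
    abel
  -- At the target of a vertical edge the difference lies in the kernel of the restriction map.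
  have htgt : ∀ E : G.Edge, E.tgt = D.s E.src → n ≤ D.level E.tgt →
      ∃ ν, γ E.tgt - Φ.twist γ E.tgt = symOf k (D.c E.tgt) • ν := by
    intro E hv hn
    have hn' : n ≤ D.level E.src := by rwa [level_eq (D.eq_s_comm.1 hv)]
    have h0 : B.rho E.tgt E (Or.inr rfl) (γ E.tgt - Φ.twist γ E.tgt) = 0 := by
      rw [map_sub, Φ.twist_apply γ hv hn', Φ.vertical E hv hn', hγ E hn', sub_self]
    obtain ⟨m, hm⟩ := (hB.rho_tgt_ker E _).1 h0
    rcases D.label_vertical E.adj hv with hl | hl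
    · exact ⟨m, by rw [hm]; congr 2⟩
    · refine ⟨-m, ?_⟩
      rw [hm, smul_neg, ← neg_smul, ← symOf_neg]
      congr 2
  have hex : ∀ x, ∃ ν, n ≤ D.level x → γ x - Φ.twist γ x = symOf k (D.c x) • ν := by
    intro x
    by_cases hn : n ≤ D.level x
    swap
    · exact ⟨0, fun h => absurd h hn⟩
    rcases D.adj_vertical x with h | h
    · have hn' : n ≤ D.level (D.s x) := by rwa [D.level_s]
      obtain ⟨ν, hν⟩ := htgt ⟨_, _, h⟩ rfl hn'
      refine ⟨(Φ.φ (D.s x) x (D.s_s x).symm hn').toLinearEquiv ν, fun _ => ?_⟩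
      rw [hanti (D.s x) x (D.s_s x).symm hn', hν, map_smul, D.c_s, symOf_neg, neg_smul, neg_neg]
    · obtain ⟨ν, hν⟩ := htgt ⟨_, _, h⟩ (D.s_s x).symm hn
      exact ⟨ν, fun _ => hν⟩
  choose ν hν using hex
  refine ⟨ν, fun E hE => ?_, hν⟩
  have hs : n ≤ D.level E.src := hE
  have ht : n ≤ D.level E.tgt := le_trans hs (D.level_mono E.src_lt_tgt.le)
  by_cases hv : E.tgt = D.s E.src
  · -- The quotient is invariant under the symmetry.
    have h1 : ν E.tgt = (Φ.φ _ _ hv hs).toLinearEquiv (ν E.src) := by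
      rw [← sub_eq_zero]
      refine eq_zero_of_smul_eq_zero_of_projective (D.c_regular E.tgt) ?_
      have h2 := hanti _ _ hv hs
      have hc : D.c E.tgt = -D.c E.src := by rw [← D.c_s, ← hv]
      rw [hν _ hs, hν _ ht, map_smul, ← neg_smul, ← symOf_neg, ← hc] at h2
      rw [smul_sub, h2, sub_self]
    rw [h1, Φ.vertical E hv hs]
  · rw [← sub_eq_zero]
    obtain ⟨p, hp⟩ := hB.rho_tgt_surjective E
      (B.rho E.src E (Or.inl rfl) (ν E.src) - B.rho E.tgt E (Or.inr rfl) (ν E.tgt))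
    obtain ⟨l, hl⟩ := D.c_adj E.adj
    have h1 : B.rho E.tgt E (Or.inr rfl) (symOf k (D.c E.tgt) • p) = 0 := by
      rw [map_smul, hp, smul_sub, ← map_smul _ _ (ν E.tgt), ← hν _ ht,
        B.smul_eq_smul_of_label (E := E) hl, ← map_smul, ← hν _ hs, map_sub, map_sub, hγ E hs,
        Φ.isSectionOn_twist hγ E hs, sub_self]
    obtain ⟨q, hq⟩ := (hB.rho_tgt_ker E _).1 h1
    obtain ⟨q', hq'⟩ := exists_eq_smul_of_projective (D.c_regular_mod hv (Or.inr rfl)) hq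
    rw [← hp, (hB.rho_tgt_ker E p).2 ⟨q', hq'⟩]

/-- If an element of the stalk at the upper vertex `y` of the next level matches a section, then an
element with the same image in the module of the vertical edge matches the twisted section. -/
lemma exists_stalk_of_twist (hB : B.IsBradenMacPherson) {y : V} (hy : D.s y < y)
    (hn : n ≤ D.level y + 1) {γ : ∀ x, B.stalk x} (hγ : B.IsSectionOn {x | n ≤ D.level x} γ)
    (m : B.stalk y) (hm : ∀ (E : G.Edge) (h : E.src = y),
      B.rho y E (Or.inl h) m = B.rho E.tgt E (Or.inr rfl) (γ E.tgt)) :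
    ∃ m' : B.stalk y, (∀ (E : G.Edge) (h : E.src = y),
      B.rho y E (Or.inl h) m' = B.rho E.tgt E (Or.inr rfl) (Φ.twist γ E.tgt)) ∧
      ∀ (E : G.Edge) (h : E.tgt = y), E.tgt = D.s E.src →
        B.rho y E (Or.inr h) m' = B.rho y E (Or.inr h) m := by
  have habove : ∀ z, y < z → n ≤ D.level z := by
    intro z hz
    rcases D.eq_or_level_lt hz with rfl | h
    · exact absurd hz hy.asymm
    · omega
  obtain ⟨ν, hν, hν'⟩ := Φ.exists_section_of_sub_twist hB hγ
  obtain ⟨b, hb⟩ := hB.exists_stalk_of_section (hν.mono (J' := Set.Ioi y) habove)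
  refine ⟨m - symOf k (D.c y) • b, fun E h => ?_, fun E h hv => ?_⟩
  · have ht : n ≤ D.level E.tgt := habove _ (by rw [← h]; exact E.src_lt_tgt)
    obtain ⟨l, hl⟩ := D.c_adj E.adj
    subst h
    rw [map_sub, map_smul, hm E rfl, hb E rfl, ← B.smul_eq_smul_of_label (E := E) hl, ← map_smul,
      ← hν' _ ht, map_sub]
    abel
  · subst h
    rw [map_sub, map_smul, sub_eq_self]
    rcases D.label_vertical E.adj hv with hl | hl
    · rw [← hl]
      exact B.label_smul E _
    · rw [← neg_eq_iff_eq_neg] at hl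
      rw [← hl, symOf_neg, neg_smul]
      exact neg_eq_zero.2 (B.label_smul E _)

end PartialIso

/-! ### Extending the isomorphisms to the next level -/

namespace PartialIso

variable {n : ℕ}

lemma tgt_ne_of_src_eq {y : V} (hy : D.s y < y) {E : G.Edge} (h : E.src = y) :
    E.tgt ≠ D.s E.src := by
  intro h'
  have := E.src_lt_tgt
  rw [h', h] at this
  exact this.asymm hy

/-- The isomorphism between the stalks at the two vertices `x = s y < y` of the next level. It is
compatible with the isomorphisms above on pairs of parallel edges starting at `y` and `x`, and with
the identity on the edge from `x` to `y`. -/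
lemma exists_stalkIso [Finite V] (Φ : D.PartialIso B (n + 1)) (hB : B.IsBradenMacPherson)
    {x y : V} (hxy : x = D.s y) (hlt : x < y) (hn : D.level y = n) :
    ∃ θ : GrIso (B.stalk y) (B.stalk x),
      (∀ (E E' : G.Edge) (_ : D.Parallel E E') (hs : E.src = y) (hs' : E'.src = x)
        (v v' : V) (hv : v' = D.s v) (ht : E.tgt = v) (ht' : E'.tgt = v')
        (hl : n + 1 ≤ D.level v) (m : B.stalk y) (p : B.stalk v),
        B.rho y E (Or.inl hs) m = B.rho v E (Or.inr ht) p ↔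
          B.rho x E' (Or.inl hs') (θ.toLinearEquiv m) =
            B.rho v' E' (Or.inr ht') ((Φ.φ v v' hv hl).toLinearEquiv p)) ∧
      ∀ (E : G.Edge) (hs : E.src = x) (ht : E.tgt = y) (m : B.stalk y),
        B.rho x E (Or.inl hs) (θ.toLinearEquiv m) = B.rho y E (Or.inr ht) m := by
  have hsy : D.s y < y := hxy ▸ hlt
  have hyx : y = D.s x := D.eq_s_comm.1 hxy
  have hlx : D.level x = n := by rw [level_eq hxy, hn]
  have hnt : ∀ E : G.Edge, E.src = y → E.tgt ≠ D.s E.src := fun E h => tgt_ne_of_src_eq hsy h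
  have htgt : ∀ E : G.Edge, E.src = y → n + 1 ≤ D.level E.tgt := by
    intro E h
    have := level_lt_of_ne (hnt E h)
    rw [h, hn] at this
    omega
  choose ψ hψ using fun (E E' : G.Edge) (h : D.Parallel E E') (ht : n + 1 ≤ D.level E.tgt) =>
    Φ.exists_edgeIso hB h ht
  -- The relation of having the same images in all edge modules.
  let Z : Submodule (LatticeSym k Y) (B.stalk y × B.stalk x) :=
    { carrier := {z | (∀ (E E' : G.Edge) (h : D.Parallel E E') (hs : E.src = y) (hs' : E'.src = x),
          (ψ E E' h (htgt E hs)).toLinearEquiv (B.rho y E (Or.inl hs) z.1) =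
            B.rho x E' (Or.inl hs') z.2) ∧
        ∀ (E : G.Edge) (hs : E.src = x) (ht : E.tgt = y),
          B.rho x E (Or.inl hs) z.2 = B.rho y E (Or.inr ht) z.1}
      add_mem' := fun {a b} ha hb => ⟨fun E E' h hs hs' => by
          simp only [Prod.fst_add, Prod.snd_add, map_add, ha.1 E E' h hs hs', hb.1 E E' h hs hs'],
        fun E hs ht => by
          simp only [Prod.fst_add, Prod.snd_add, map_add, ha.2 E hs ht, hb.2 E hs ht]⟩
      zero_mem' := ⟨fun E E' h hs hs' => by simp, fun E hs ht => by simp⟩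
      smul_mem' := fun a z hz => ⟨fun E E' h hs hs' => by
          simp only [Prod.smul_fst, Prod.smul_snd, map_smul, hz.1 E E' h hs hs'],
        fun E hs ht => by
          simp only [Prod.smul_fst, Prod.smul_snd, map_smul, hz.2 E hs ht]⟩ }
  have hmemZ : ∀ p q, (p, q) ∈ Z ↔
      (∀ (E E' : G.Edge) (h : D.Parallel E E') (hs : E.src = y) (hs' : E'.src = x),
          (ψ E E' h (htgt E hs)).toLinearEquiv (B.rho y E (Or.inl hs) p) =
            B.rho x E' (Or.inl hs') q) ∧
        ∀ (E : G.Edge) (hs : E.src = x) (ht : E.tgt = y),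
          B.rho x E (Or.inl hs) q = B.rho y E (Or.inr ht) p := fun _ _ => Iff.rfl
  clear_value Z
  have hZ : ∀ p q, (p, q) ∈ Z → ∀ i,
      ((B.stalk y).component i p, (B.stalk x).component i q) ∈ Z := by
    intro p q h i
    rw [hmemZ] at h ⊢
    refine ⟨fun E E' hE hs hs' => ?_, fun E hs ht => ?_⟩
    · rw [← B.component_rho (Or.inl hs) i p, ← B.component_rho (Or.inl hs') i q,
        ← GrIso.component_map, h.1 E E' hE hs hs']
    · rw [← B.component_rho (Or.inl hs) i q, ← B.component_rho (Or.inr ht) i p, h.2 E hs ht]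
  have hJ : ∀ z, y < z → n + 1 ≤ D.level z := by
    intro z hz
    rcases D.eq_or_level_lt hz with rfl | h
    · exact absurd hz hsy.asymm
    · omega
  have hJ' : ∀ z, x < z → z = y ∨ n + 1 ≤ D.level z := by
    intro z hz
    rcases D.eq_or_level_lt hz with rfl | h
    · exact Or.inl hyx.symm
    · exact Or.inr (by omega)
  -- Totality over `y`: twist a section matching `p`, correct `p` such that it matches the twist, and
  -- extend the resulting section from `y` and above to `x`.
  have hZP : ∀ p, ∃ q, (p, q) ∈ Z := by
    intro p
    obtain ⟨γ, hγ, hp⟩ := hB.exists_section_of_stalk p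
    have hγ' : B.IsSectionOn {x | n + 1 ≤ D.level x} γ := hγ.mono (Set.subset_univ _)
    obtain ⟨p', hp', hvp⟩ := Φ.exists_stalk_of_twist hB hsy (by omega) hγ' p hp
    obtain ⟨γ', hy', hne⟩ : ∃ γ' : ∀ x, B.stalk x, γ' y = p' ∧ ∀ v, v ≠ y → γ' v = Φ.twist γ v := by
      classical
      exact ⟨Function.update (Φ.twist γ) y p', Function.update_self _ _ _,
        fun v hv => Function.update_of_ne hv _ _⟩
    have hsec : B.IsSectionOn (Set.Ioi x) γ' := by
      intro E hE
      rcases hJ' _ hE with h | h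
      · have htne : E.tgt ≠ y := by rw [← h]; exact E.src_lt_tgt.ne'
        rw [hne _ htne, ← hp' E h]
        subst h
        rw [hy']
      · have h1 : E.src ≠ y := by intro h'; rw [h'] at h; omega
        have h2 : E.tgt ≠ y := by
          intro h'
          have := D.level_mono E.src_lt_tgt.le
          rw [h'] at this
          omega
        rw [hne _ h1, hne _ h2]
        exact Φ.isSectionOn_twist hγ' E h
    obtain ⟨q, hq⟩ := hB.exists_stalk_of_section hsec
    refine ⟨q, (hmemZ _ _).2 ⟨fun E E' h hs hs' => ?_, fun E hs ht => ?_⟩⟩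
    · have h1 := htgt E hs
      have h2 : E'.tgt ≠ y := by
        intro h'
        have := level_eq h.2
        rw [h'] at this
        omega
      rw [hp E hs, hψ, hq E' hs', hne _ h2, Φ.twist_apply γ h.2 h1]
    · rw [hq E hs, ← hvp E ht (by rw [ht, hs, hyx])]
      subst ht
      rw [hy']
  -- Totality over `x`: correct the value at `y` of a section matching `q` such that it matches the
  -- twist.
  have hZQ : ∀ q, ∃ p, (p, q) ∈ Z := by
    intro q
    obtain ⟨γ, hγ, hq⟩ := hB.exists_section_of_stalk q
    have hγ' : B.IsSectionOn {x | n + 1 ≤ D.level x} γ := hγ.mono (Set.subset_univ _)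
    obtain ⟨p, hp, hvp⟩ := Φ.exists_stalk_of_twist hB hsy (by omega) hγ' (γ y) (by
      intro E h
      subst h
      exact hγ E (Set.mem_univ _))
    refine ⟨p, (hmemZ _ _).2 ⟨fun E E' h hs hs' => ?_, fun E hs ht => ?_⟩⟩
    · have h1 := htgt E hs
      have h2 : n + 1 ≤ D.level E'.tgt := by rwa [level_eq h.2]
      rw [hp E hs, hψ, hq E' hs', Φ.twist_apply γ h.symm.2 h2, Φ.φ_φ]
    · rw [hq E hs, hvp E ht (by rw [ht, hs, hyx])]
      subst ht
      rfl
  have hP : ∀ L : Submodule (LatticeSym k Y) (B.stalk y), (B.stalk y).IsHomogeneous L →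
      (∀ q, ∃ p ∈ L, (p, q) ∈ Z) → L = ⊤ := by
    intro L hL h
    by_cases hy : y = ⊤
    · subst hy
      obtain ⟨e, he⟩ := hB.stalk_top
      obtain ⟨E, hEx, hv, -⟩ := D.exists_vertical x
      obtain ⟨hs, ht⟩ : E.src = x ∧ E.tgt = (⊤ : V) := by
        rcases hEx with h | h
        · exact ⟨h, by rw [hv, h, ← hyx]⟩
        · have := E.src_lt_tgt
          rw [D.eq_s_comm.1 hv, h, ← hyx] at this
          exact absurd this hlt.asymm
      refine eq_top_of_equiv_symAlgebra he E.label hL fun m => ?_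
      obtain ⟨q, hq⟩ := hZP m
      obtain ⟨m', hm', hq'⟩ := h q
      obtain ⟨p, hp⟩ := (hB.rho_eq_zero_iff ht (m - m')).1 (by
        rw [map_sub, ← ((hmemZ _ _).1 hq).2 E hs ht, ((hmemZ _ _).1 hq').2 E hs ht, sub_self])
      exact ⟨m', hm', p, by rw [← hp]; abel⟩
    · obtain ⟨-, hr, hess⟩ := hB.cover y (D.exists_outEdge y hy)
      refine hess L hL ?_
      rw [← hr]
      refine le_antisymm LinearMap.map_le_range ?_
      rintro _ ⟨m, rfl⟩
      obtain ⟨q, hq⟩ := hZP m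
      obtain ⟨m', hm', hq'⟩ := h q
      refine ⟨m', hm', ?_⟩
      funext E
      obtain ⟨E, hE⟩ := E
      obtain ⟨E', hEE'⟩ := exists_parallel (hnt E hE)
      have hs' : E'.src = x := by rw [hEE'.1, hE, ← hxy]
      apply (ψ E E' hEE' (htgt E hE)).toLinearEquiv.injective
      exact (((hmemZ _ _).1 hq').1 E E' hEE' hE hs').trans
        (((hmemZ _ _).1 hq).1 E E' hEE' hE hs').symm
  have hQ : ∀ L : Submodule (LatticeSym k Y) (B.stalk x), (B.stalk x).IsHomogeneous L →
      (∀ p, ∃ q ∈ L, (p, q) ∈ Z) → L = ⊤ := by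
    intro L hL h
    have hx : x ≠ ⊤ := (hlt.trans_le le_top).ne
    obtain ⟨-, hr, hess⟩ := hB.cover x (D.exists_outEdge x hx)
    refine hess L hL ?_
    rw [← hr]
    refine le_antisymm LinearMap.map_le_range ?_
    rintro _ ⟨m, rfl⟩
    obtain ⟨p, hp⟩ := hZQ m
    obtain ⟨m', hm', hp'⟩ := h p
    refine ⟨m', hm', ?_⟩
    funext E
    obtain ⟨E, hE⟩ := E
    by_cases hv : E.tgt = D.s E.src
    · have ht : E.tgt = y := by rw [hv, hE, ← hyx]
      exact (((hmemZ _ _).1 hp').2 E hE ht).trans (((hmemZ _ _).1 hp).2 E hE ht).symm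
    · obtain ⟨E', hEE'⟩ := exists_parallel hv
      have hs' : E'.src = y := by rw [hEE'.1, hE, ← hyx]
      exact (((hmemZ _ _).1 hp').1 E' E hEE'.symm hs' hE).symm.trans
        (((hmemZ _ _).1 hp).1 E' E hEE'.symm hs' hE)
  have hproj := hB.projective D.exists_outEdge
  obtain ⟨θ, hθ⟩ := exists_grIso_of_relation (hproj y) (hproj x) Z hZ hZP hZQ hP hQ
  refine ⟨θ, ?_, fun E hs ht m => ((hmemZ _ _).1 (hθ m)).2 E hs ht⟩
  rintro E E' hEE' hs hs' v v' hv rfl rfl hl m p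
  have h1 := ((hmemZ _ _).1 (hθ m)).1 E E' hEE' hs hs'
  rw [← h1, ← hψ E E' hEE' hl p]
  exact (ψ E E' hEE' hl).toLinearEquiv.injective.eq_iff.symm

/-- The system of isomorphisms extends to the next level. -/
lemma nonempty_of_succ [Finite V] (Φ : D.PartialIso B (n + 1)) (hB : B.IsBradenMacPherson) :
    Nonempty (D.PartialIso B n) := by
  classical
  choose θ hθ hθv using fun (x y : V) (hxy : x = D.s y) (hlt : x < y) (hn : D.level y = n) =>
    Φ.exists_stalkIso hB hxy hlt hn
  have hlt_or : ∀ y y', y' = D.s y → y' < y ∨ y < y' := by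
    rintro y y' rfl
    rcases D.adj_vertical y with h | h
    · exact Or.inr (G.lt_of_adj h)
    · exact Or.inl (G.lt_of_adj h)
  let φ : ∀ y y' : V, y' = D.s y → n ≤ D.level y → GrIso (B.stalk y) (B.stalk y') :=
    fun y y' h hn =>
      if h1 : n + 1 ≤ D.level y then Φ.φ y y' h h1
      else if h2 : y' < y then θ y' y h h2 (by omega)
      else (θ y y' (D.eq_s_comm.1 h) ((hlt_or y y' h).resolve_left h2)
        (by rw [level_eq h]; omega)).symm
  have hφ1 : ∀ y y' h hn (h1 : n + 1 ≤ D.level y), φ y y' h hn = Φ.φ y y' h h1 := by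
    intro y y' h hn h1
    simp only [φ]
    rw [dif_pos h1]
  have hφ2 : ∀ y y' h hn (h1 : D.level y = n) (h2 : y' < y), φ y y' h hn = θ y' y h h2 h1 := by
    intro y y' h hn h1 h2
    simp only [φ]
    rw [dif_neg (by omega), dif_pos h2]
  have hφ3 : ∀ y y' h hn (h1 : D.level y' = n) (h2 : y < y'),
      φ y y' h hn = (θ y y' (D.eq_s_comm.1 h) h2 h1).symm := by
    intro y y' h hn h1 h2
    simp only [φ]
    rw [dif_neg (by rw [level_eq (D.eq_s_comm.1 h)]; omega), dif_neg h2.asymm]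
  clear_value φ
  refine ⟨⟨φ, ?_, ?_, ?_⟩⟩
  · intro y y' h h' hn hn' m
    have hl := level_eq h
    rcases hn.lt_or_eq with h1 | h1
    · rw [hφ1 y y' h hn h1, hφ1 y' y h' hn' (by omega), Φ.φ_φ]
    · rcases hlt_or y y' h with h2 | h2
      · rw [hφ2 y y' h hn h1.symm h2, hφ3 y' y h' hn' h1.symm h2]
        exact LinearEquiv.symm_apply_apply _ _
      · rw [hφ3 y y' h hn (by omega) h2, hφ2 y' y h' hn' (by omega) h2]
        exact LinearEquiv.apply_symm_apply _ _
  · intro E E' h hs ht m p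
    have hl := level_eq h.1
    have hl' := level_eq h.2
    have hst := level_lt_of_ne h.tgt_ne
    rw [hφ1 _ _ h.2 ht (by omega)]
    rcases hs.lt_or_eq with h1 | h1
    · rw [hφ1 _ _ h.1 hs h1]
      exact Φ.parallel E E' h h1 (by omega) m p
    · rcases hlt_or _ _ h.1 with h2 | h2
      · rw [hφ2 _ _ h.1 hs h1.symm h2]
        exact hθ _ _ _ h2 h1.symm E E' h rfl rfl _ _ h.2 rfl rfl _ m p
      · rw [hφ3 _ _ h.1 hs (by omega) h2]
        have := hθ _ _ (D.eq_s_comm.1 h.1) h2 (by omega) E' E h.symm rfl rfl _ _ h.symm.2 rfl rfl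
          (by omega) ((θ _ _ (D.eq_s_comm.1 h.1) h2 (by omega)).symm.toLinearEquiv m)
          ((Φ.φ _ _ h.2 (by omega)).toLinearEquiv p)
        rw [Φ.φ_φ] at this
        rw [this, GrIso.symm_toLinearEquiv, LinearEquiv.apply_symm_apply]
  · intro E h hn m
    rcases hn.lt_or_eq with h1 | h1
    · rw [hφ1 _ _ h hn h1]
      exact Φ.vertical E h h1 m
    · have hl := level_eq h
      rw [hφ3 _ _ h hn (by omega) E.src_lt_tgt]
      rw [← hθv _ _ (D.eq_s_comm.1 h) E.src_lt_tgt (by omega) E rfl rfl, GrIso.symm_toLinearEquiv,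
        LinearEquiv.apply_symm_apply]

end PartialIso

/-! ### The symmetry of Braden–MacPherson sheaves -/

/-- Downward induction on the level. -/
lemma nonempty_partialIso [Finite V] (hB : B.IsBradenMacPherson) (n : ℕ) :
    Nonempty (D.PartialIso B n) := by
  have key : ∀ m n, D.level ⊤ + 1 ≤ n + m → Nonempty (D.PartialIso B n) := by
    intro m
    induction m with
    | zero =>
      intro n hn
      have h : ∀ x, ¬ n ≤ D.level x := fun x hx => by
        have := D.level_mono (le_top (a := x))
        omega
      exact ⟨⟨fun y _ _ hy => absurd hy (h y), fun y _ _ _ hy => absurd hy (h y),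
        fun E _ _ hs => absurd hs (h _), fun E _ hs => absurd hs (h _)⟩⟩
    | succ m ih =>
      intro n hn
      obtain ⟨Φ⟩ := ih (n + 1) (by omega)
      exact Φ.nonempty_of_succ hB
  exact key (D.level ⊤ + 1) n (by omega)

variable (D) in
/-- The edge `E'` is the translate of the edge `E`, in one of the two directions. -/
def Translate (E E' : G.Edge) : Prop :=
  (E'.src = D.s E.src ∧ E'.tgt = D.s E.tgt) ∨ (E'.tgt = D.s E.src ∧ E'.src = D.s E.tgt)

lemma Translate.parallel_or_eq {E E' : G.Edge} (h : D.Translate E E') :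
    D.Parallel E E' ∨ (E.tgt = D.s E.src ∧ E' = E) := by
  rcases h with h | h
  · exact Or.inl h
  · right
    have hv : E.tgt = D.s E.src := by
      by_contra hne
      have h1 := level_lt_of_ne hne
      have h2 := D.level_mono E'.src_lt_tgt.le
      rw [h.1, h.2, D.level_s, D.level_s] at h2
      omega
    exact ⟨hv, Edge.eq_of_src_tgt (by rw [h.2, hv, D.s_s]) (by rw [h.1, hv])⟩

variable (D) in
lemma existsUnique_translate (E : G.Edge) : ∃! E', D.Translate E E' := by
  by_cases hv : E.tgt = D.s E.src
  · refine ⟨E, Or.inr ⟨hv, D.eq_s_comm.1 hv⟩, fun E' h => ?_⟩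
    exact (h.parallel_or_eq.resolve_left fun h => h.tgt_ne hv).2
  · obtain ⟨E', h⟩ := exists_parallel hv
    refine ⟨E', Or.inl h, fun E'' h' => ?_⟩
    have := h'.parallel_or_eq.resolve_right fun h => hv h.1
    exact Edge.eq_of_src_tgt (this.1.trans h.1.symm) (this.2.trans h.2.symm)

lemma Translate.tgt {E E' : G.Edge} (h : D.Translate E E') : E'.Incident (D.s E.tgt) := by
  rcases h with h | h
  · exact Or.inr h.2
  · exact Or.inl h.2

/-- A folding symmetry of a moment graph lifts to an involution of its Braden–MacPherson sheaf. -/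
theorem exists_sheaf_involution [Finite V] (D : G.FoldingSymmetry k)
    (hB : B.IsBradenMacPherson) :
    ∃ (φ : ∀ y y' : V, y' = D.s y → GrIso (B.stalk y) (B.stalk y'))
      (ψ : ∀ E E' : G.Edge, D.Translate E E' → GrIso (B.edge E) (B.edge E')),
      (∀ (y y' : V) (hy : y' = D.s y) (E E' : G.Edge) (hE : D.Translate E E')
          (hyE : E.Incident y) (hyE' : E'.Incident y') (m : B.stalk y),
        B.rho y' E' hyE' ((φ y y' hy).toLinearEquiv m) =
          (ψ E E' hE).toLinearEquiv (B.rho y E hyE m)) ∧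
      (∀ (y y' : V) (hy : y' = D.s y) (hy' : y = D.s y'),
        (φ y' y hy').toLinearEquiv = (φ y y' hy).toLinearEquiv.symm) ∧
      (∀ (E E' : G.Edge) (hE : D.Translate E E') (hE' : D.Translate E' E),
        (ψ E' E hE').toLinearEquiv = (ψ E E' hE).toLinearEquiv.symm) := by
  obtain ⟨Φ⟩ := nonempty_partialIso (D := D) hB 0
  let φ : ∀ y y' : V, y' = D.s y → GrIso (B.stalk y) (B.stalk y') :=
    fun y y' h => Φ.φ y y' h (Nat.zero_le _)
  have hψ : ∀ E E' (_ : D.Translate E E'), ∃ ψ : GrIso (B.edge E) (B.edge E'),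
      ∀ (y y' : V) (hy : y' = D.s y) (hyE : E.Incident y) (hyE' : E'.Incident y')
        (m : B.stalk y), B.rho y' E' hyE' ((φ y y' hy).toLinearEquiv m) =
          ψ.toLinearEquiv (B.rho y E hyE m) := by
    intro E E' h
    rcases h.parallel_or_eq with h | ⟨hv, rfl⟩
    · obtain ⟨ψ, hψ⟩ := Φ.exists_edgeIso hB h (Nat.zero_le _)
      refine ⟨ψ, fun y y' hy hyE hyE' m => ?_⟩
      rcases hyE with rfl | rfl
      · obtain rfl : E'.src = y' := h.1.trans hy.symm
        obtain ⟨p, hp⟩ := hB.rho_tgt_surjective E (B.rho E.src E (Or.inl rfl) m)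
        rw [← hp, hψ]
        exact (Φ.parallel E E' h (Nat.zero_le _) (Nat.zero_le _) m p).1 hp.symm
      · obtain rfl : E'.tgt = y' := h.2.trans hy.symm
        exact (hψ m).symm
    · refine ⟨GrIso.refl _, fun y y' hy hyE hyE' m => ?_⟩
      rcases hyE with rfl | rfl
      · obtain rfl : E'.tgt = y' := hv.trans hy.symm
        exact Φ.vertical E' hv (Nat.zero_le _) m
      · obtain rfl : E'.src = y' := (D.eq_s_comm.1 hv).trans hy.symm
        exact Φ.vertical_symm E' hy (Nat.zero_le _) m
  choose ψ hψ using hψ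
  have hφφ : ∀ y y' (hy : y' = D.s y) (hy' : y = D.s y') m,
      (φ y' y hy').toLinearEquiv ((φ y y' hy).toLinearEquiv m) = m :=
    fun y y' hy hy' m => Φ.φ_φ y y' hy hy' _ _ m
  refine ⟨φ, ψ, fun y y' hy E E' hE => hψ E E' hE y y' hy, fun y y' hy hy' => ?_,
    fun E E' hE hE' => ?_⟩
  · ext m
    rw [LinearEquiv.eq_symm_apply]
    exact hφφ y' y hy' hy m
  · ext m
    rw [LinearEquiv.eq_symm_apply]
    obtain ⟨m, rfl⟩ := hB.rho_tgt_surjective E' m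
    have h1 := hψ E' E hE' _ _ rfl (Or.inr rfl) hE'.tgt m
    have h2 := hψ E E' hE _ _ (D.s_s _).symm hE'.tgt (Or.inr rfl)
      ((φ _ _ rfl).toLinearEquiv m)
    rw [← h1, ← h2, hφφ]

end MomentGraph.FoldingSymmetry

/-! ### The symmetry of the Bruhat graph -/

namespace KMRealization

variable {ι : Type*} [Fintype ι] [DecidableEq ι] {A : Matrix ι ι ℤ}
  {H : Type*} [AddCommGroup H] [Module ℂ H] (R : KMRealization A H)

/-- Right multiplication by a simple reflection on the Bruhat graph below an element `w` with
`w s_i < w`. -/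
noncomputable def bruhatFolding (k : Type*) [CommRing k] (w : R.weylGroup) (i : ι)
    (hws : w * R.simple i < w) (hGKM : (R.bruhatGraphBelow w).IsGKMPair k) :
    (R.bruhatGraphBelow w).FoldingSymmetry k where
  s x := ⟨x.1 * R.simple i, R.mul_simple_le hws x.2⟩
  s_s x := Subtype.ext (R.mul_simple_cancel x.1 i)
  level x := R.pairLength i x.1
  level_s x := R.pairLength_mul_simple i x.1
  eq_or_level_lt {x y} h := by
    rcases R.eq_mul_simple_or_pairLength_lt i (Subtype.coe_lt_coe.2 h) with h | h
    · exact Or.inl (Subtype.ext h)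
    · exact Or.inr h
  adj_vertical x := by
    rcases R.lt_mul_simple_or x.1 i with h | h
    · exact Or.inl (R.bruhatGraph_adj_vertical h)
    · right
      have := R.bruhatGraph_adj_vertical (x := x.1 * R.simple i) (i := i)
        (by rwa [R.mul_simple_cancel])
      rw [R.mul_simple_cancel] at this
      exact this
  adj_s {x y} h := by
    rcases R.bruhatGraph_adj_mul_simple h i with h' | h'
    · exact Or.inl (Subtype.ext h')
    · refine Or.inr ⟨h', R.bruhatGraph_label_congr h' h ?_⟩
      rw [mul_inv_rev, R.simple_inv, mul_assoc, ← mul_assoc (R.simple i), R.simple_mul_self,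
        one_mul]
  c x := R.corootAt i x.1
  c_s x := R.corootAt_mul_simple i x.1
  label_vertical {x y} h hy := R.label_vertical h (congrArg Subtype.val hy)
  c_adj {x y} h := R.corootAt_sub_mem i h
  exists_outEdge x hx := by
    obtain ⟨t, ht, hl, hle⟩ := exists_step_of_lt (R := R) (x := x.1) (y := w)
      (lt_of_le_of_ne x.2 fun h => hx (Subtype.ext h))
    exact ⟨⟨x, ⟨t * x.1, hle⟩, ht.lt_mul hl, by
      change R.IsReflection (t * x.1 * (x.1)⁻¹)
      rwa [mul_inv_cancel_right]⟩, rfl⟩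
  label_regular {x y} h a ha := by
    obtain ⟨b, j, hb⟩ := R.exists_basis_label h
    refine eq_zero_of_symOf_basis_mul b j a ?_
    rw [hb]
    exact ha
  label_regular_mod E E' hne hx a b h := by
    obtain ⟨e, j, he⟩ := R.exists_basis_label E'.adj
    have hl : E'.label = e j := he.symm
    have hi := hGKM E E' hne hx
    rw [hl] at h hi ⊢
    exact exists_eq_symOf_basis_mul e j hi a b h

end KMRealization

theorem theorem6p1 {k : Type*} [CommRing k] [IsLocalRing k] (h2 : IsUnit (2 : k))
    {ι : Type*} [Fintype ι] [DecidableEq ι] {A : Matrix ι ι ℤ}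
    {H : Type*} [AddCommGroup H] [Module ℂ H] (R : KMRealization A H)
    (w : R.weylGroup) (i : ι) (hws : w * R.simple i < w)
    (hGKM : (R.bruhatGraphBelow w).IsGKMPair k)
    (B : KSheaf.{v} k (R.bruhatGraphBelow w)) (hB : B.IsBradenMacPherson) :
    (∀ y : Set.Iic w, ∃ y' : Set.Iic w, R.IsRightTranslate (R.simple i) y y') ∧
    (∀ E : (R.bruhatGraphBelow w).Edge, ∃! E' : (R.bruhatGraphBelow w).Edge,
      R.IsRightTranslateEdge (R.simple i) E E') ∧
    ∃ (φ : ∀ y y' : Set.Iic w, R.IsRightTranslate (R.simple i) y y' →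
          GrIso (B.stalk y) (B.stalk y'))
      (ψ : ∀ E E' : (R.bruhatGraphBelow w).Edge, R.IsRightTranslateEdge (R.simple i) E E' →
          GrIso (B.edge E) (B.edge E')),
      (∀ (y y' : Set.Iic w) (hy : R.IsRightTranslate (R.simple i) y y')
          (E E' : (R.bruhatGraphBelow w).Edge)
          (hE : R.IsRightTranslateEdge (R.simple i) E E')
          (hyE : E.Incident y) (hyE' : E'.Incident y') (m : B.stalk y),
        B.rho y' E' hyE' ((φ y y' hy).toLinearEquiv m) =
          (ψ E E' hE).toLinearEquiv (B.rho y E hyE m)) ∧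
      (∀ (y y' : Set.Iic w) (hy : R.IsRightTranslate (R.simple i) y y')
          (hy' : R.IsRightTranslate (R.simple i) y' y),
        (φ y' y hy').toLinearEquiv = (φ y y' hy).toLinearEquiv.symm) ∧
      (∀ (E E' : (R.bruhatGraphBelow w).Edge)
          (hE : R.IsRightTranslateEdge (R.simple i) E E')
          (hE' : R.IsRightTranslateEdge (R.simple i) E' E),
        (ψ E' E hE').toLinearEquiv = (ψ E E' hE).toLinearEquiv.symm) := by
  have : Finite (Set.Iic w) := R.finite_Iic w
  let D := R.bruhatFolding k w i hws hGKM
  have hvertex : ∀ y y', R.IsRightTranslate (w := w) (R.simple i) y y' ↔ y' = D.s y :=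
    fun y y' => ⟨fun h => Subtype.ext h, fun h => congrArg Subtype.val h⟩
  have hedge : ∀ E E', R.IsRightTranslateEdge (w := w) (R.simple i) E E' ↔ D.Translate E E' := by
    intro E E'
    simp only [KMRealization.IsRightTranslateEdge, MomentGraph.FoldingSymmetry.Translate, hvertex]
  obtain ⟨φ, ψ, h1, h3, h4⟩ := D.exists_sheaf_involution hB
  refine ⟨fun y => ⟨D.s y, rfl⟩, fun E => ?_, fun y y' h => φ y y' ((hvertex y y').1 h),
    fun E E' h => ψ E E' ((hedge E E').1 h), ?_, ?_, ?_⟩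
  · simpa only [hedge] using D.existsUnique_translate E
  · intro y y' hy E E' hE hyE hyE' m
    exact h1 y y' _ E E' _ hyE hyE' m
  · intro y y' hy hy'
    exact h3 y y' _ _
  · intro E E' hE hE'
    exact h4 E E' _ _
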